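/- Let $n>3$ and let $C_n^+(1,3)$ be the directed graph with vertices $0,1,\dots,n-1$ (taken mod $n$) and with a bond from $v$ to $w$ if and only if $w-v\equiv 1$ or $w-v\equiv 3 \pmod n$. A periodic orbit is a closed walk with at least one bond, up to rotation, and its length is its number of bonds, counted with repetition; it is primitive if it is not a shorter periodic orbit repeated two or more times. A primitive pseudo orbit is a finite set of distinct primitive periodic orbits, and its length is the sum of their lengths. A self-intersection, or $r$-encounter ($r\ge 2$), of a pseudo orbit is a maximal sequence of consecutive vertices $v_0,v_1,\dots,v_h$ that is repeated exactly $r$ times in the pseudo orbit, whether within one periodic orbit, in several, or both; its length is the number $h$ of its bonds. Then for all integers $0<l\le n$ and $N>0$, the number of primitive pseudo orbits on $C_n^+(1,3)$ of length $l$ with exactly $N$ self-intersections, each of which is a $2$-encounter of length zero, is $$2^N\,\frac{n}{N}\binom{\frac l2-N}{n-l+N}\binom{\frac l2-N-1}{N-1},$$ where a binomial coefficient $\binom{x}{y}$ is read as $0$ unless $x$ and $y$ are integers with $0\le y\le x$. -/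

import Mathlib

/-- The directed circulant graph on the vertices `0, …, n - 1` (taken mod `n`) whose set of arcs is
`A`: there is a bond from `v` to `w` exactly when `w ≡ v + a (mod n)` for some `a ∈ A`. -/
def circulantDigraph (n : ℕ) (A : Set ℕ) : Digraph (ZMod n) where
  Adj v w := ∃ a ∈ A, w = v + (a : ZMod n)

/-- A periodic orbit: a closed walk with at least one bond, up to rotation. The cycle of vertices
`[v₀, …, v_{l-1}]` stands for the circuit `v₀, v₁, …, v_{l-1}, v₀`; `Cycle.Chain` says that all
consecutive vertices, including the last and the first, are joined by a bond. -/
structure PeriodicOrbit {V : Type*} (G : Digraph V) where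
  verts : Cycle V
  ne_nil : verts ≠ Cycle.nil
  chain : verts.Chain G.Adj

namespace PeriodicOrbit

variable {V : Type*} {G : Digraph V}

/-- The number of bonds, counted with repetition. -/
def length (γ : PeriodicOrbit G) : ℕ := γ.verts.length

/-- A periodic orbit is primitive if it is not a shorter one repeated several times. -/
def IsPrimitive (γ : PeriodicOrbit G) : Prop :=
  ¬ ∃ (x : List V) (k : ℕ), 2 ≤ k ∧ γ.verts = ((List.replicate k x).flatten : Cycle V)

/-- The number of times that the sequence of vertices `L` is traversed by `γ`: the number of
starting positions on `γ` from which `γ`, followed cyclically, runs through `L`.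
(`Cycle.lists` is the multiset of the circuits of `γ`, one for each starting position.) -/
def mult [DecidableEq V] (γ : PeriodicOrbit G) (L : List V) : ℕ :=
  γ.verts.lists.countP (fun x => ∀ j < L.length, x[j % x.length]? = L[j]?)

end PeriodicOrbit

/-- A pseudo orbit: a finite collection of periodic orbits, repetitions allowed. -/
abbrev PseudoOrbit {V : Type*} (G : Digraph V) := Multiset (PeriodicOrbit G)

namespace PseudoOrbit

variable {V : Type*} {G : Digraph V}

/-- The sum of the lengths of the periodic orbits in the collection. -/
def length (Γ : PseudoOrbit G) : ℕ := (Γ.map PeriodicOrbit.length).sum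

/-- All the periodic orbits are primitive, and none is repeated. -/
def IsPrimitive (Γ : PseudoOrbit G) : Prop :=
  (∀ γ ∈ Γ, γ.IsPrimitive) ∧ Γ.Nodup

/-- The total number of times that the sequence of vertices `L` is traversed in `Γ`. -/
def mult [DecidableEq V] (Γ : PseudoOrbit G) (L : List V) : ℕ :=
  (Γ.map fun γ => γ.mult L).sum

/-- `L = [v₀, …, v_h]` is an `r`-encounter of `Γ`: a maximal sequence of vertices that is
repeated exactly `r` times in `Γ`, where `r ≥ 2`. (`<:+:` means: contiguous subsequence.) -/
def IsEncounter [DecidableEq V] (Γ : PseudoOrbit G) (r : ℕ) (L : List V) : Prop :=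
  2 ≤ r ∧ L ≠ [] ∧ Γ.mult L = r ∧ ∀ L' : List V, L <:+: L' → Γ.mult L' = r → L' = L

/-- The length of an encounter `v₀, …, v_h` is its number `h` of bonds. -/
def encounterLength (L : List V) : ℕ := L.length - 1

/-- The self-intersections of `Γ`: all its `r`-encounters, for all `r ≥ 2`. -/
def selfIntersections [DecidableEq V] (Γ : PseudoOrbit G) : Set (List V) :=
  {L | ∃ r, Γ.IsEncounter r L}

end PseudoOrbit

/-- The primitive pseudo orbits on `G` of length `l` that have exactly `N` self-intersections, each
of which is a `2`-encounter of length zero. -/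
def primitivePseudoOrbits {V : Type*} [DecidableEq V] (G : Digraph V) (l N : ℕ) :
    Set (PseudoOrbit G) :=
  {Γ | Γ.IsPrimitive ∧ Γ.length = l ∧
    Γ.selfIntersections.Finite ∧ Γ.selfIntersections.ncard = N ∧
    ∀ L ∈ Γ.selfIntersections, Γ.IsEncounter 2 L ∧ PseudoOrbit.encounterLength L = 0}

/-- The binomial coefficient `x` over `y`, read as `0` unless `x` and `y` are both nonnegative
integers (and, as usual, `0` if `y > x`). -/
def binom (x y : ℚ) : ℕ :=
  if x = ⌊x⌋₊ ∧ y = ⌊y⌋₊ then Nat.choose ⌊x⌋₊ ⌊y⌋₊ else 0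

/-! A primitive pseudo orbit has only encounters of length zero exactly when it traverses no bond
twice. Otherwise take a longest repeated sequence with at least one bond; it exists because distinct
circuits of primitive orbits part within a bounded number of steps, and it is an encounter of
positive length. As at most two bonds leave a vertex, the encounters that remain are the vertices
visited twice (`mem_primitivePseudoOrbits`).

Such a pseudo orbit is the cycle decomposition of a permutation that sends each used bond to one
starting where it ends (`bijOn_hasPerm`). On a balanced set of bonds the permutation is chosen
independently at each vertex, in two ways at each of the N vertices with two outgoing bonds. This
gives 2^N times the number of balanced sets (`finite_and_ncard_primitivePseudoOrbits`).

Let x v and y v in {0, 1} tell whether the bonds from v to v + 1 and v + 3 are used. Balance means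
that k = x v + y v + y (v - 1) + y (v - 2) does not depend on v, and l ≤ n with N > 0 forces k = 2
(`window_eq_two`). Then y determines x, and y is any cyclic word without three equal consecutive
letters; l is twice its number Z of zeros, and N its number of pairs of consecutive zeros
(`card_balancedSets`).

Such a word consists of b = Z - N blocks 0(0)1(1), with N doubled zeros and M = n - l + N doubled
ones. Counting words with a marked block start gives b · #words = n · C(b, N) · C(b, M)
(`mul_card_cyclicWords`), and C(b, N) / b = C(b - 1, N - 1) / N turns this into the formula. -/

/-! ### Linear binary words as sequences of blocks -/

/-- The binary word made of the blocks `0 (0) 1 (1)`, where each pair of Booleans tells whether the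
zero and whether the one of the corresponding block are doubled. -/
def blockWord : List (Bool × Bool) → List Bool
  | [] => []
  | (false, false) :: s => false :: true :: blockWord s
  | (true, false) :: s => false :: false :: true :: blockWord s
  | (false, true) :: s => false :: true :: true :: blockWord s
  | (true, true) :: s => false :: false :: true :: true :: blockWord s

/-- The number of positions at which a word has two consecutive zeros. -/
def doubleZeros : List Bool → ℕ
  | [] => 0
  | [_] => 0
  | a :: b :: t => (if a = false ∧ b = false then 1 else 0) + doubleZeros (b :: t)

theorem doubleZeros_true_cons (w : List Bool) : doubleZeros (true :: w) = doubleZeros w := by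
  cases w <;> simp [doubleZeros]

theorem length_blockWord (s : List (Bool × Bool)) :
    (blockWord s).length = 2 * s.length + s.countP Prod.fst + s.countP Prod.snd := by
  induction s with
  | nil => simp [blockWord]
  | cons p s ih => rcases p with ⟨_ | _, _ | _⟩ <;> simp [blockWord, ih] <;> ring

theorem count_false_blockWord (s : List (Bool × Bool)) :
    (blockWord s).count false = s.length + s.countP Prod.fst := by
  induction s with
  | nil => simp [blockWord]
  | cons p s ih => rcases p with ⟨_ | _, _ | _⟩ <;> simp [blockWord, ih] <;> ring

/-- Every block ends in a one, so two adjacent zeros lie in one block. The appended zero stands for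
the letter that follows cyclically. -/
theorem doubleZeros_blockWord (s : List (Bool × Bool)) :
    doubleZeros (blockWord s ++ [false]) = s.countP Prod.fst := by
  induction s with
  | nil => simp [blockWord, doubleZeros]
  | cons p s ih =>
    rcases p with ⟨_ | _, _ | _⟩ <;>
      simp [blockWord, doubleZeros, doubleZeros_true_cons, ih] <;> ring

theorem blockWord_eq_nil_or (s : List (Bool × Bool)) :
    blockWord s = [] ∨ ∃ t, blockWord s = false :: t := by
  rcases s with _ | ⟨⟨_ | _, _ | _⟩, s⟩ <;> simp [blockWord]

/-- A word can be decoded from the left: what follows a block is empty or begins with a zero, so a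
single one is never mistaken for a doubled one. -/
theorem blockWord_injective : Function.Injective blockWord := by
  intro s
  induction s with
  | nil => rintro (_ | ⟨⟨_ | _, _ | _⟩, t⟩) h <;> simp_all [blockWord]
  | cons p s ih =>
    rintro (_ | ⟨⟨_ | _, _ | _⟩, t⟩) h <;> rcases p with ⟨_ | _, _ | _⟩ <;>
      simp only [blockWord, List.cons.injEq, true_and, reduceCtorEq, false_and] at h ⊢ <;>
      first
      | exact ih h
      | (rcases blockWord_eq_nil_or s with h1 | ⟨u, h1⟩ <;>
          rcases blockWord_eq_nil_or t with h2 | ⟨u', h2⟩ <;> simp_all)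

theorem getLast?_blockWord (s : List (Bool × Bool)) (hs : blockWord s ≠ []) :
    (blockWord s).getLast? = some true := by
  induction s with
  | nil => simp [blockWord] at hs
  | cons p s ih =>
    by_cases h : blockWord s = []
    · rcases p with ⟨_ | _, _ | _⟩ <;> simp [blockWord, h]
    · rcases p with ⟨_ | _, _ | _⟩ <;> simp [blockWord, List.getLast?_cons, ih h]

/-- A word without three equal consecutive letters. -/
def NoTripleList : List Bool → Prop
  | a :: b :: c :: t => ¬(a = b ∧ b = c) ∧ NoTripleList (b :: c :: t)
  | _ => True

theorem noTripleList_blockWord (s : List (Bool × Bool)) : NoTripleList (blockWord s) := by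
  induction s with
  | nil => simp [blockWord, NoTripleList]
  | cons p s ih =>
    rcases p with ⟨_ | _, _ | _⟩ <;> rcases s with _ | ⟨⟨_ | _, _ | _⟩, s⟩ <;>
      simp_all [blockWord, NoTripleList]

theorem NoTripleList.not_eq {w : List Bool} (h : NoTripleList w) (i : ℕ) (hi : i + 2 < w.length) :
    ¬(w[i] = w[i + 1] ∧ w[i + 1] = w[i + 2]) := by
  induction w generalizing i with
  | nil => simp at hi
  | cons a w ih =>
    rcases w with _ | ⟨b, _ | ⟨c, t⟩⟩
    · simp at hi
    · simp at hi
    · rcases i with _ | i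
      · simpa using h.1
      · exact ih h.2 i (by simpa using hi)

/-- Strong induction, removing the first block. Taking `f` on all of `ℕ` lets the periodic extension
of a cyclic word be inserted, so that the letters beyond the end are those after the seam. -/
theorem exists_blockWord_eq (n : ℕ) (f : ℕ → Bool) (h0 : f 0 = false) (hn : f n = false)
    (hl : n ≠ 0 → f (n - 1) = true) (h : ∀ i, ¬(f i = f (i + 1) ∧ f (i + 1) = f (i + 2))) :
    ∃ s, blockWord s = (List.range n).map f := by
  induction n using Nat.strong_induction_on generalizing f with
  | _ n ih =>
  have key : ∀ k, 0 < k → k ≤ n → f k = false →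
      ∃ s, blockWord s = (List.range (n - k)).map (fun i => f (i + k)) := by
    intro k hk hkn hfk
    refine ih (n - k) (by omega) (fun i => f (i + k)) (by simpa using hfk) ?_ ?_ ?_
    · simpa [Nat.sub_add_cancel hkn] using hn
    · intro h'
      have := hl (by omega)
      simpa [show n - k - 1 + k = n - 1 by omega] using this
    · intro i
      have := h (i + k)
      simpa [add_right_comm] using this
  have split : ∀ k, k ≤ n → (List.range n).map f =
      (List.range k).map f ++ (List.range (n - k)).map (fun i => f (i + k)) := by
    intro k hk
    conv_lhs => rw [← Nat.add_sub_cancel' hk, List.range_add]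
    simp [Function.comp_def, add_comm]
  -- The word can stop neither after a zero nor before a one; hence the block being removed fits
  -- into the first `n` letters.
  have ne : ∀ k, 0 < k → f (k - 1) = false → n ≠ k := by
    rintro k hk h1 rfl
    simp [hl (by omega)] at h1
  have ne' : ∀ k, f k = true → n ≠ k := by
    rintro k h1 rfl
    simp [hn] at h1
  rcases Nat.eq_zero_or_pos n with rfl | hpos
  · exact ⟨[], by simp [blockWord]⟩
  have n1 := ne 1 one_pos h0
  have t0 := h 0
  have t1 := h 1
  have t2 := h 2
  simp only [zero_add, Nat.reduceAdd] at t0 t1 t2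
  cases h1 : f 1
  · have h2 : f 2 = true := by simpa [h0, h1] using t0
    have n2 := ne' 2 h2
    cases h3 : f 3
    · obtain ⟨s, hs⟩ := key 3 (by omega) (by omega) h3
      exact ⟨(true, false) :: s, by
        rw [split 3 (by omega), blockWord, hs]; simp [List.range_succ, h0, h1, h2]⟩
    · have n3 := ne' 3 h3
      have h4 : f 4 = false := by simpa [h2, h3] using t2
      obtain ⟨s, hs⟩ := key 4 (by omega) (by omega) h4
      exact ⟨(true, true) :: s, by
        rw [split 4 (by omega), blockWord, hs]; simp [List.range_succ, h0, h1, h2, h3]⟩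
  · cases h2 : f 2
    · obtain ⟨s, hs⟩ := key 2 (by omega) (by omega) h2
      exact ⟨(false, false) :: s, by
        rw [split 2 (by omega), blockWord, hs]; simp [List.range_succ, h0, h1]⟩
    · have n2 := ne' 2 h2
      have h3 : f 3 = false := by simpa [h1, h2] using t1
      obtain ⟨s, hs⟩ := key 3 (by omega) (by omega) h3
      exact ⟨(false, true) :: s, by
        rw [split 3 (by omega), blockWord, hs]; simp [List.range_succ, h0, h1, h2]⟩

theorem count_false_map_range (f : ℕ → Bool) (n : ℕ) :
    ((List.range n).map f).count false = Nat.count (fun i => f i = false) n := by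
  induction n with
  | zero => simp
  | succ n ih =>
    rw [List.range_succ, List.map_append, List.count_append, ih, Nat.count_succ]
    cases h : f n <;> simp [h]

/-- The extra letter `f n` makes the pair at position `n - 1`, which crosses the seam of a cyclic
word, count. -/
theorem doubleZeros_map_range (f : ℕ → Bool) (n : ℕ) :
    doubleZeros ((List.range (n + 1)).map f) =
      Nat.count (fun i => f i = false ∧ f (i + 1) = false) n := by
  induction n generalizing f with
  | zero => simp [doubleZeros]
  | succ n ih =>
    have := ih (fun i => f (i + 1))
    rw [List.range_succ_eq_map, List.map_cons, List.map_map]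
    rw [List.range_succ_eq_map, List.map_cons, List.map_map] at this ⊢
    rw [Nat.count_succ', ← this, doubleZeros]
    simp [Function.comp_def, add_comm]

theorem ZMod.card_filter_eq_count (n : ℕ) [NeZero n] (P : ZMod n → Prop) [DecidablePred P] :
    (Finset.univ.filter P).card = Nat.count (fun i => P (i : ZMod n)) n := by
  rw [Nat.count_eq_card_filter_range]
  refine Finset.card_nbij' ZMod.val (fun i => (i : ZMod n)) ?_ ?_ ?_ ?_
  · intro v hv
    simpa [ZMod.val_lt] using hv
  · intro i hi
    simpa using (Finset.mem_filter.1 hi).2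
  · intro v _
    simp
  · intro i hi
    exact ZMod.val_cast_of_lt (by simpa using (Finset.mem_filter.1 hi).1)

theorem List.countP_ofFn_eq_card {α : Type*} {b : ℕ} (f : Fin b → α) (g : α → Bool) :
    (List.ofFn f).countP g = (Finset.univ.filter fun i => g (f i) = true).card := by
  induction b with
  | zero => simp
  | succ b ih =>
    rw [List.ofFn_succ, List.countP_cons, ih, Fin.card_filter_univ_succ]
    split_ifs <;> simp_all [add_comm]

/-! ### Counting cyclic words without triples -/

/-- A cyclic word without three equal consecutive letters. -/
def NoTriple {n : ℕ} (y : ZMod n → Bool) : Prop :=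
  ∀ v, ¬(y v = y (v + 1) ∧ y (v + 1) = y (v + 2))

/-- The lists of `b` blocks with `N` doubled zeros and `M` doubled ones. -/
def blockLists (b N M : ℕ) : Set (List (Bool × Bool)) :=
  {s | s.length = b ∧ s.countP Prod.fst = N ∧ s.countP Prod.snd = M}

/-- The doubled zeros and the doubled ones are two independent subsets of the `b` blocks. -/
theorem ncard_blockLists (b N M : ℕ) : (blockLists b N M).ncard = b.choose N * b.choose M := by
  let F : Finset (Fin b) × Finset (Fin b) → List (Bool × Bool) :=
    fun p => List.ofFn fun i => (decide (i ∈ p.1), decide (i ∈ p.2))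
  have hF : Function.Injective F := by
    rintro ⟨S, T⟩ ⟨S', T'⟩ h
    have h' := List.ofFn_injective h
    simp only [Prod.mk.injEq]
    constructor <;> ext i <;> have := congrFun h' i <;> simp at this <;> tauto
  have himg : blockLists b N M = F '' ((Finset.univ.powersetCard N ×ˢ
      Finset.univ.powersetCard M : Finset (Finset (Fin b) × Finset (Fin b))) : Set _) := by
    ext s
    simp only [blockLists, Set.mem_ofPred_eq, Set.mem_image, Finset.coe_product, Set.mem_prod,
      Finset.mem_coe, Finset.mem_powersetCard, Finset.subset_univ, true_and]
    constructor
    · rintro ⟨rfl, rfl, rfl⟩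
      have hs : s = List.ofFn fun i : Fin s.length => s[i] := by simp
      refine ⟨(Finset.univ.filter fun i : Fin s.length => s[i].1 = true,
        Finset.univ.filter fun i : Fin s.length => s[i].2 = true), ⟨?_, ?_⟩, ?_⟩
      · conv_rhs => rw [hs, List.countP_ofFn_eq_card]
      · conv_rhs => rw [hs, List.countP_ofFn_eq_card]
      · simp [F]
    · rintro ⟨⟨S, T⟩, ⟨rfl, rfl⟩, rfl⟩
      simp [F, List.countP_ofFn_eq_card]
  rw [himg, Set.ncard_image_of_injective _ hF, Set.ncard_coe_finset, Finset.card_product,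
    Finset.card_powersetCard, Finset.card_powersetCard, Finset.card_univ, Fintype.card_fin]

open Classical in
/-- The cyclic binary words of length `n` without three equal consecutive letters that have
`Z` zeros and `N` pairs of consecutive zeros. -/
noncomputable def cyclicWords (n Z N : ℕ) [NeZero n] : Finset (ZMod n → Bool) :=
  Finset.univ.filter fun y => NoTriple y ∧ (Finset.univ.filter fun v => y v = false).card = Z ∧
    (Finset.univ.filter fun v => y v = false ∧ y (v + 1) = false).card = N

section

variable {n Z N : ℕ} [NeZero n]

theorem mem_cyclicWords {y : ZMod n → Bool} : y ∈ cyclicWords n Z N ↔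
    NoTriple y ∧ (Finset.univ.filter fun v => y v = false).card = Z ∧
    (Finset.univ.filter fun v => y v = false ∧ y (v + 1) = false).card = N := by
  simp [cyclicWords]

/-- The zeros of a cyclic word which do not precede a zero are counted by the ones that precede
a zero. -/
theorem card_blockStarts (y : ZMod n → Bool) :
    (Finset.univ.filter fun v => y v = false ∧ y (v - 1) = true).card +
      (Finset.univ.filter fun v => y v = false ∧ y (v + 1) = false).card =
      (Finset.univ.filter fun v => y v = false).card := by
  -- Shifting by one turns the zeros followed by a zero into the zeros preceded by one.
  have h : (Finset.univ.filter fun v => y v = false ∧ y (v + 1) = false).card =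
      (Finset.univ.filter fun v => y v = false ∧ y (v - 1) = false).card := by
    refine Finset.card_nbij' (· + 1) (· - 1) ?_ ?_ ?_ ?_ <;> intro v <;> simp <;> tauto
  rw [h, ← Finset.card_union_of_disjoint]
  · congr 1
    ext v
    cases h1 : y v <;> cases h2 : y (v - 1) <;> simp [h1, h2]
  · rw [Finset.disjoint_left]
    intro v
    simp +contextual

/-- If a block starts at `0`, cutting the circle there splits no block, so the cyclic word is a list
of blocks. -/
theorem card_filter_cyclicWords_zero (hn : 1 < n) {b M : ℕ} (hZ : Z = b + N)
    (hM : n = 2 * b + N + M) :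
    ((cyclicWords n Z N).filter fun y => y 0 = false ∧ y (0 - 1) = true).card =
      b.choose N * b.choose M := by
  classical
  rw [← ncard_blockLists, ← Set.ncard_coe_finset]
  symm
  have hval : ∀ (y : ZMod n → Bool) (w : List Bool),
      w = (List.range n).map (fun i : ℕ => y (i : ZMod n)) → ∀ i (hi : i < w.length),
        w[i] = y (i : ZMod n) := by
    rintro y w rfl i hi
    simp
  refine Set.ncard_congr (fun s _ => fun v : ZMod n => (blockWord s).getD v.val false) ?_ ?_ ?_
  · rintro s ⟨hb, hN, hM'⟩
    have hlen : (blockWord s).length = n := by rw [length_blockWord, hb, hN, hM', hM]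
    set y : ZMod n → Bool := fun v => (blockWord s).getD v.val false with hy
    have hmap : (List.range n).map (fun i : ℕ => y (i : ZMod n)) = blockWord s := by
      apply List.ext_getElem
      · simp [hlen]
      · intro i hi hi'
        have : i < n := hlen ▸ hi'
        simp [hy, Nat.mod_eq_of_lt this, hi']
    have hv : ∀ i (hi : i < (blockWord s).length), (blockWord s)[i] = y (i : ZMod n) :=
      hval y _ hmap.symm
    have hne : blockWord s ≠ [] := by
      intro h
      rw [h] at hlen
      simp at hlen
      omega
    have hy0 : y 0 = false := by
      rcases blockWord_eq_nil_or s with h | ⟨t, h⟩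
      · exact absurd h hne
      · simp [hy, h]
    have hyl : y ((n - 1 : ℕ) : ZMod n) = true := by
      have h := getLast?_blockWord s hne
      rw [List.getLast?_eq_getElem?, hlen, List.getElem?_eq_getElem (by omega)] at h
      rw [← hv (n - 1) (by omega)]
      simpa using h
    have hpred : ((n - 1 : ℕ) : ZMod n) = 0 - 1 := by
      rw [Nat.cast_sub (by omega)]; simp
    simp only [Finset.coe_filter, mem_cyclicWords, Set.mem_ofPred_eq]
    refine ⟨⟨?_, ?_, ?_⟩, hy0, hpred ▸ hyl⟩
    · intro v
      obtain ⟨i, hi, rfl⟩ : ∃ i < n, (i : ZMod n) = v := ⟨v.val, v.val_lt, by simp⟩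
      by_cases h2 : i + 2 < n
      · have := (noTripleList_blockWord s).not_eq i (by omega)
        rw [hv, hv, hv] at this
        simpa using this
      -- A window across the seam contains the final one and the initial zero, so it is not
      -- constant.
      · rcases (show i = n - 1 ∨ i = n - 2 by omega) with rfl | rfl
        · have : ((n - 1 : ℕ) : ZMod n) + 1 = 0 := by rw [hpred]; ring
          rw [this, hyl, hy0]
          simp
        · have h1 : ((n - 2 : ℕ) : ZMod n) + 1 = ((n - 1 : ℕ) : ZMod n) := by
            rw [show n - 1 = n - 2 + 1 by omega]; push_cast; ring
          have h2 : ((n - 2 : ℕ) : ZMod n) + 2 = 0 := by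
            rw [Nat.cast_sub (by omega)]; simp
          rw [h1, h2, hyl, hy0]
          simp
    · rw [ZMod.card_filter_eq_count, ← count_false_map_range (fun i => y (i : ZMod n)), hmap,
        count_false_blockWord, hb, hN, hZ]
    · rw [ZMod.card_filter_eq_count]
      have := doubleZeros_map_range (fun i => y (i : ZMod n)) n
      push_cast at this
      rw [← this, List.range_succ, List.map_append, hmap, ← hN, ← doubleZeros_blockWord]
      simp [hy0]
  · rintro s t ⟨h1, h2, h3⟩ ⟨h1', h2', h3'⟩ h
    apply blockWord_injective
    have hlen : (blockWord s).length = n := by rw [length_blockWord, h1, h2, h3, hM]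
    have hlen' : (blockWord t).length = n := by rw [length_blockWord, h1', h2', h3', hM]
    apply List.ext_getElem
    · rw [hlen, hlen']
    · intro i hi hi'
      have := congrFun h (i : ZMod n)
      have hin : i < n := by omega
      simpa [ZMod.val_cast_of_lt hin, hi, hi'] using this
  · intro y hy
    simp only [Finset.coe_filter, mem_cyclicWords, Set.mem_ofPred_eq] at hy
    obtain ⟨⟨hT, hZ', hN'⟩, h0, hl⟩ := hy
    have hpred : ((n - 1 : ℕ) : ZMod n) = 0 - 1 := by
      rw [Nat.cast_sub (by omega)]; simp
    obtain ⟨s, hs⟩ := exists_blockWord_eq n (fun i => y (i : ZMod n)) (by simpa using h0)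
      (by simpa using h0) (fun _ => by simpa [hpred] using hl)
      (fun i => by simpa using hT (i : ZMod n))
    have hN1 : s.countP Prod.fst = N := by
      have := doubleZeros_map_range (fun i => y (i : ZMod n)) n
      rw [List.range_succ, List.map_append, ← hs] at this
      rw [← doubleZeros_blockWord, ← hN', ZMod.card_filter_eq_count]
      simpa [h0] using this
    have hZ1 := count_false_blockWord s
    rw [hs, count_false_map_range, ← ZMod.card_filter_eq_count n (fun v => y v = false), hZ', hN1]
      at hZ1
    have hM1 := length_blockWord s
    rw [hs, hN1] at hM1
    simp at hM1
    refine ⟨s, ⟨by omega, hN1, by omega⟩, ?_⟩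
    funext v
    simp [hs, v.val_lt]

theorem card_filter_cyclicWords (v : ZMod n) :
    ((cyclicWords n Z N).filter fun y => y v = false ∧ y (v - 1) = true).card =
      ((cyclicWords n Z N).filter fun y => y 0 = false ∧ y (0 - 1) = true).card := by
  have hT : ∀ (y : ZMod n → Bool) (c : ZMod n), NoTriple y → NoTriple fun u => y (u + c) := by
    intro y c h u
    have := h (u + c)
    simpa [add_right_comm] using this
  have hZ : ∀ (P : ZMod n → Prop) [DecidablePred P] (c : ZMod n),
      (Finset.univ.filter fun u => P (u + c)).card = (Finset.univ.filter P).card := by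
    intro P _ c
    refine Finset.card_nbij' (· + c) (· - c) ?_ ?_ ?_ ?_ <;> intro v <;> simp
  have hmem : ∀ (y : ZMod n → Bool) (c : ZMod n), y ∈ cyclicWords n Z N →
      (fun u => y (u + c)) ∈ cyclicWords n Z N := by
    intro y c h
    rw [mem_cyclicWords] at h ⊢
    refine ⟨hT y c h.1, ?_, ?_⟩
    · rw [hZ fun u => y u = false, h.2.1]
    · simp only [add_right_comm _ 1 c]
      rw [hZ fun u => y u = false ∧ y (u + 1) = false, h.2.2]
  refine Finset.card_nbij' (fun y u => y (u + v)) (fun y u => y (u + -v)) ?_ ?_ ?_ ?_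
  · intro y hy
    simp only [Finset.coe_filter, Set.mem_ofPred_eq] at hy ⊢
    exact ⟨hmem y v hy.1, by simpa using hy.2.1, by simpa [sub_eq_neg_add] using hy.2.2⟩
  · intro y hy
    simp only [Finset.coe_filter, Set.mem_ofPred_eq] at hy ⊢
    exact ⟨hmem y (-v) hy.1, by simpa using hy.2.1,
      by simpa [sub_eq_add_neg, add_right_comm] using hy.2.2⟩
  · intro y _
    simp
  · intro y _
    simp

/-- Double counting of words with a marked block start: each word has `Z - N = b` of them, and by
rotation each position is marked equally often. -/
theorem mul_card_cyclicWords (hn : 1 < n) {b M : ℕ} (hZ : Z = b + N) (hM : n = 2 * b + N + M) :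
    b * (cyclicWords n Z N).card = n * (b.choose N * b.choose M) := by
  have h1 : ∑ y ∈ cyclicWords n Z N,
      (Finset.univ.filter fun v => y v = false ∧ y (v - 1) = true).card =
      ∑ v : ZMod n, ((cyclicWords n Z N).filter fun y => y v = false ∧ y (v - 1) = true).card := by
    simp only [Finset.card_filter]
    exact Finset.sum_comm
  have h2 : ∀ y ∈ cyclicWords n Z N,
      (Finset.univ.filter fun v => y v = false ∧ y (v - 1) = true).card = b := by
    intro y hy
    rw [mem_cyclicWords] at hy
    have := card_blockStarts y
    omega
  rw [Finset.sum_congr rfl h2] at h1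
  simp only [card_filter_cyclicWords, card_filter_cyclicWords_zero hn hZ hM] at h1
  simp only [Finset.sum_const, smul_eq_mul, Finset.card_univ, ZMod.card] at h1
  rw [mul_comm, h1]

/-- Without block starts every zero is preceded by a zero, so a single zero produces three in a row;
and the word of ones only is excluded as well. -/
theorem cyclicWords_eq_empty (h : Z ≤ N) : cyclicWords n Z N = ∅ := by
  rw [Finset.eq_empty_iff_forall_notMem]
  intro y hy
  rw [mem_cyclicWords] at hy
  have h1 := card_blockStarts y
  have h2 : (Finset.univ.filter fun v => y v = false ∧ y (v - 1) = true).card = 0 := by omega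
  rw [Finset.card_eq_zero, Finset.filter_eq_empty_iff] at h2
  have h3 : ∀ v, y (v + 1) = false → y v = false := by
    intro v hv
    have := @h2 (v + 1) (Finset.mem_univ _)
    simpa [hv] using this
  have h4 : ∀ v, y (v + 2) = true := by
    intro v
    by_contra hv
    simp only [Bool.not_eq_true] at hv
    have e1 : y (v + 1) = false := h3 _ (by rwa [add_assoc, one_add_one_eq_two])
    have e0 : y v = false := h3 _ e1
    exact hy.1 v ⟨by rw [e0, e1], by rw [e1, hv]⟩
  have h5 : ∀ v, y v = true := fun v => by simpa using h4 (v - 2)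
  exact hy.1 0 ⟨by simp [h5], by simp [h5]⟩

end

/-! ### Consecutive pairs, primitivity and periods of lists -/

namespace List

variable {V : Type*}

/-- The list of pairs of consecutive elements of a list, closed up cyclically. -/
def cyclicPairs (l : List V) : List (V × V) := l.zip (l.rotate 1)

theorem length_cyclicPairs (l : List V) : l.cyclicPairs.length = l.length := by
  simp [cyclicPairs]

theorem cyclicPairs_rotate (l : List V) (k : ℕ) :
    (l.rotate k).cyclicPairs = l.cyclicPairs.rotate k := by
  rw [cyclicPairs, cyclicPairs, zip_eq_zipWith, zip_eq_zipWith,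
    zipWith_rotate_distrib _ _ _ _ (by simp),
    rotate_rotate, rotate_rotate, add_comm]

theorem map_fst_cyclicPairs (l : List V) : l.cyclicPairs.map Prod.fst = l :=
  map_fst_zip (by simp)

theorem map_snd_cyclicPairs (l : List V) : l.cyclicPairs.map Prod.snd = l.rotate 1 :=
  map_snd_zip (by simp)

theorem isChain_cons_append_iff {r : V → V → Prop} (a c : V) (t : List V) :
    IsChain r (a :: (t ++ [c])) ↔ ∀ e ∈ (a :: t).zip (t ++ [c]), r e.1 e.2 := by
  induction t generalizing a with
  | nil => simp
  | cons b t ih =>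
    rw [cons_append, isChain_cons_cons, ih]
    simp

/-- Relates multiplicities, counted over starting positions, to bonds. The index `1 % x.length`
makes the vertex of a one-element list its own successor. -/
theorem map_cyclicPermutations (l : List V) (hl : l ≠ []) :
    l.cyclicPermutations.map (fun x => (x[0]?, x[1 % x.length]?)) =
      l.cyclicPairs.map fun e => (some e.1, some e.2) := by
  have hpos : 0 < l.length := length_pos_iff.2 hl
  apply ext_getElem
  · simp [length_cyclicPairs, length_cyclicPermutations_of_ne_nil _ hl]
  · intro i h1 h2
    have hi : i < l.length := by simpa [length_cyclicPairs] using h2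
    have h3 : 1 % l.length < l.length := Nat.mod_lt _ hpos
    simp only [getElem_map, getElem_cyclicPermutations, cyclicPairs, getElem_zip, length_rotate]
    rw [getElem?_eq_getElem (by simpa using hpos), getElem?_eq_getElem (by simpa using h3)]
    simp [getElem_rotate, Nat.mod_eq_of_lt hi, add_comm]

theorem rotate_length_flatten_replicate (x : List V) (k : ℕ) :
    (replicate k x).flatten.rotate x.length = (replicate k x).flatten := by
  rcases k with _ | k
  · simp
  · conv_lhs => rw [replicate_succ, flatten_cons, rotate_append_length_eq]
    rw [replicate_succ', flatten_append]
    simp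

/-- A list that is not a shorter one repeated several times. -/
def IsPrimitive (l : List V) : Prop :=
  ¬∃ (x : List V) (k : ℕ), 2 ≤ k ∧ l = (replicate k x).flatten

/-- The periodic sequence obtained by repeating a list. -/
def repeated (l : List V) (j : ℕ) : Option V := l[j % l.length]?

theorem repeated_add_length (l : List V) (j : ℕ) : l.repeated (j + l.length) = l.repeated j := by
  simp [repeated]

theorem repeated_of_lt {l : List V} {j : ℕ} (h : j < l.length) : l.repeated j = l[j]? := by
  simp [repeated, Nat.mod_eq_of_lt h]

theorem eq_of_repeated_eq {l l' : List V} (h : l.length = l'.length)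
    (h' : l.repeated = l'.repeated) : l = l' := by
  apply ext_getElem?
  intro i
  by_cases hi : i < l.length
  · rw [← repeated_of_lt hi, h', repeated_of_lt (h ▸ hi)]
  · rw [getElem?_eq_none (by omega), getElem?_eq_none (by omega)]

theorem getElem?_flatten_replicate (x : List V) (k j : ℕ) (hj : j < k * x.length) :
    (replicate k x).flatten[j]? = x.repeated j := by
  induction k generalizing j with
  | zero => simp at hj
  | succ k ih =>
    rw [replicate_succ, flatten_cons]
    by_cases h : j < x.length
    · rw [getElem?_append_left h, repeated_of_lt h]
    · rw [getElem?_append_right (by omega), ih _ (by rw [Nat.succ_mul] at hj; omega),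
        ← repeated_add_length]
      congr 1
      omega

end List

/-- Euclid's algorithm: `b % a` is a period because `j + b % a` reaches `j + b` by steps of `a`. -/
theorem Function.Periodic.nat_gcd {α : Type*} {f : ℕ → α} {a b : ℕ} (ha : Function.Periodic f a)
    (hb : Function.Periodic f b) : Function.Periodic f (a.gcd b) := by
  induction a, b using Nat.gcd.induction with
  | H0 b => simpa using hb
  | H1 a b _ ih =>
    rw [Nat.gcd_rec]
    refine ih (fun j => ?_) ha
    have h := ha.nat_mul (b / a) (j + b % a)
    rw [← h, add_assoc]
    have : b % a + ((b / a : ℕ) : ℕ) * a = b := by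
      rw [mul_comm]; exact Nat.mod_add_div b a
    simp only [Nat.cast_id]
    rw [this, hb]

namespace List

variable {V : Type*}

/-- The gcd of `d` and the length is a period. Were it smaller than the length, the list would be a
repetition of its prefix of that length. -/
theorem IsPrimitive.length_dvd {l : List V} (h : l.IsPrimitive) (hl : l ≠ []) {d : ℕ}
    (hd : Function.Periodic l.repeated d) : l.length ∣ d := by
  have hpos : 0 < l.length := length_pos_iff.2 hl
  set g := l.length.gcd d with hg
  have hper : Function.Periodic l.repeated g :=
    Function.Periodic.nat_gcd (fun j => l.repeated_add_length j) hd
  obtain ⟨k, hk⟩ : g ∣ l.length := Nat.gcd_dvd_left _ _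
  have hgpos : 0 < g := Nat.gcd_pos_of_pos_left _ hpos
  by_cases hk2 : 2 ≤ k
  · exfalso
    refine h ⟨l.take g, k, hk2, ?_⟩
    have hgl : g ≤ l.length := Nat.le_of_dvd hpos (Nat.gcd_dvd_left _ _)
    have hlen : (l.take g).length = g := by simp [hgl]
    apply ext_getElem?
    intro i
    by_cases hi : i < l.length
    · rw [getElem?_flatten_replicate _ _ _ (by rw [hlen, mul_comm, ← hk]; exact hi)]
      rw [← repeated_of_lt hi, ← hper.map_mod_nat i, repeated, repeated, hlen,
        getElem?_take_of_lt (Nat.mod_lt _ hgpos),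
        Nat.mod_eq_of_lt (lt_of_lt_of_le (Nat.mod_lt _ hgpos) hgl)]
    · rw [getElem?_eq_none (by omega), getElem?_eq_none]
      simp [hgl]
      rw [mul_comm, ← hk]
      omega
  · have : k = 1 := by
      rcases k with _ | _ | k
      · rw [Nat.mul_zero] at hk; omega
      · rfl
      · omega
    rw [this, mul_one] at hk
    rw [hk, hg]
    exact Nat.gcd_dvd_right _ _

theorem periodic_of_rotate_eq {l : List V} {d : ℕ} (h : l.rotate d = l) :
    Function.Periodic l.repeated d := by
  rcases eq_or_ne l [] with rfl | hl
  · intro j; simp [repeated]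
  intro j
  have hpos : 0 < l.length := length_pos_iff.2 hl
  have hj := Nat.mod_lt j hpos
  have : (l.rotate d)[j % l.length]? = l[j % l.length]? := by rw [h]
  rw [getElem?_rotate hj] at this
  rw [repeated, repeated, ← this]
  simp

/-- Two equal rotations would yield a positive period less than the length. -/
theorem IsPrimitive.nodup_cyclicPermutations {l : List V} (h : ∀ x, x ~r l → x.IsPrimitive)
    (hl : l ≠ []) : l.cyclicPermutations.Nodup := by
  have key : ∀ i j, i < j → j < l.length → l.rotate i ≠ l.rotate j := by
    intro i j hij hj he
    have hr : (l.rotate i).rotate (j - i) = l.rotate i := by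
      rw [rotate_rotate, he]
      congr 1
      omega
    have hd := (h (l.rotate i) ⟨l.length - i, by
      rw [rotate_rotate, Nat.add_sub_cancel' (by omega), rotate_length]⟩).length_dvd
        (by simpa using hl) (periodic_of_rotate_eq hr)
    rw [length_rotate] at hd
    exact absurd (Nat.le_of_dvd (by omega) hd) (by omega)
  rw [nodup_iff_injective_getElem]
  rintro ⟨i, hi⟩ ⟨j, hj⟩ he
  simp only [getElem_cyclicPermutations] at he
  rw [length_cyclicPermutations_of_ne_nil _ hl] at hi hj
  rcases lt_trichotomy i j with hij | hij | hij
  · exact absurd he (key i j hij hj)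
  · simpa using hij
  · exact absurd he.symm (key j i hij hi)

/-- The product of the lengths is a common period, so the infinite sequences agree; then each length
is a period of the other list, and the lengths divide each other. -/
theorem IsPrimitive.eq_of_repeated_eq {x y : List V} (hx : x.IsPrimitive) (hy : y.IsPrimitive)
    (hx0 : x ≠ []) (hy0 : y ≠ [])
    (h : ∀ j < x.length * y.length, x.repeated j = y.repeated j) : x = y := by
  have px : Function.Periodic x.repeated x.length := fun j => x.repeated_add_length j
  have py : Function.Periodic y.repeated y.length := fun j => y.repeated_add_length j
  have hpos : 0 < x.length * y.length :=
    Nat.mul_pos (length_pos_iff.2 hx0) (length_pos_iff.2 hy0)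
  have heq : x.repeated = y.repeated := by
    funext j
    have px' : Function.Periodic x.repeated (x.length * y.length) := by
      rw [mul_comm]; exact px.nat_mul _
    have py' : Function.Periodic y.repeated (x.length * y.length) := py.nat_mul _
    rw [← px'.map_mod_nat j, ← py'.map_mod_nat j, h _ (Nat.mod_lt _ hpos)]
  refine List.eq_of_repeated_eq (Nat.dvd_antisymm ?_ ?_) heq
  · exact hx.length_dvd hx0 (heq ▸ py)
  · exact hy.length_dvd hy0 (heq ▸ px)

end List

/-! ### The cycle of bonds of a cycle of vertices -/

namespace Cycle

variable {V : Type*}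

/-- The cycle of pairs of consecutive elements of a cycle. -/
def arcs : Cycle V → Cycle (V × V) :=
  Quotient.map' List.cyclicPairs fun l l' ⟨k, hk⟩ => ⟨k, by rw [← hk, List.cyclicPairs_rotate]⟩

theorem arcs_coe (l : List V) : (l : Cycle V).arcs = (l.cyclicPairs : Cycle (V × V)) := rfl

theorem map_fst_arcs (s : Cycle V) : s.arcs.map Prod.fst = s := by
  induction s using Quotient.inductionOn' with
  | h l => exact congrArg _ l.map_fst_cyclicPairs

theorem length_arcs (s : Cycle V) : s.arcs.length = s.length := by
  induction s using Quotient.inductionOn' with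
  | h l => exact l.length_cyclicPairs

theorem chain_iff_forall_mem_arcs {r : V → V → Prop} {s : Cycle V} :
    s.Chain r ↔ ∀ e ∈ s.arcs, r e.1 e.2 := by
  induction s using Quotient.inductionOn' with
  | h l =>
    change Cycle.Chain r (l : Cycle V) ↔ ∀ e ∈ (l.cyclicPairs : Cycle (V × V)), r e.1 e.2
    simp only [mem_coe_iff]
    rcases l with _ | ⟨a, t⟩
    · simp [List.cyclicPairs]
    · rw [chain_coe_cons, List.isChain_cons_append_iff]
      simp [List.cyclicPairs]

theorem chain_arcs (s : Cycle V) : s.arcs.Chain fun e e' => e'.1 = e.2 := by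
  rw [chain_iff_forall_mem_arcs]
  induction s using Quotient.inductionOn' with
  | h l =>
    change ∀ e ∈ (l.cyclicPairs.cyclicPairs : Cycle ((V × V) × (V × V))), e.2.1 = e.1.2
    simp only [mem_coe_iff]
    have h : l.cyclicPairs.cyclicPairs.map (fun e => e.2.1) =
        l.cyclicPairs.cyclicPairs.map (fun e => e.1.2) := by
      have h1 := congrArg (List.map Prod.fst) l.cyclicPairs.map_snd_cyclicPairs
      have h2 := congrArg (List.map Prod.snd) l.cyclicPairs.map_fst_cyclicPairs
      rw [List.map_map] at h1 h2
      rw [← List.cyclicPairs_rotate, List.map_fst_cyclicPairs] at h1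
      rw [List.map_snd_cyclicPairs] at h2
      exact h1.trans h2.symm
    exact List.map_inj_left.1 h

/-- The converse of `chain_arcs`: it recovers a closed walk from a cycle of a permutation of bonds.
-/
theorem arcs_map_fst {c : Cycle (V × V)} (h : c.Chain fun e e' => e'.1 = e.2) :
    (c.map Prod.fst).arcs = c := by
  rw [chain_iff_forall_mem_arcs] at h
  induction c using Quotient.inductionOn' with
  | h l =>
    change ∀ e ∈ (l.cyclicPairs : Cycle ((V × V) × (V × V))), e.2.1 = e.1.2 at h
    change ((l.map Prod.fst).cyclicPairs : Cycle (V × V)) = (l : Cycle (V × V))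
    simp only [mem_coe_iff] at h
    have h1 : l.cyclicPairs.map (fun e => e.2.1) = l.cyclicPairs.map (fun e => e.1.2) :=
      List.map_inj_left.2 h
    have h2 : (l.rotate 1).map Prod.fst = l.map Prod.snd := by
      rw [← List.map_snd_cyclicPairs, List.map_map]
      conv_rhs => rw [← List.map_fst_cyclicPairs l, List.map_map]
      exact h1
    congr 1
    rw [List.cyclicPairs, ← List.map_rotate, h2, List.zip_map']
    simp

theorem formPerm_eq_of_mem_arcs [DecidableEq V] {s : Cycle V} (h : s.Nodup) {p : V × V}
    (hp : p ∈ s.arcs) : s.formPerm h p.1 = p.2 := by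
  induction s using Quotient.inductionOn' with
  | h l =>
    change p ∈ (l.cyclicPairs : Cycle (V × V)) at hp
    change l.Nodup at h
    change l.formPerm p.1 = p.2
    rw [mem_coe_iff] at hp
    obtain ⟨i, hi, rfl⟩ := List.getElem_of_mem hp
    rw [List.length_cyclicPairs] at hi
    simp only [List.cyclicPairs, List.getElem_zip]
    rw [List.formPerm_apply_getElem _ h, List.getElem_rotate]

theorem exists_mem_arcs {s : Cycle V} {a : V} (h : a ∈ s) : ∃ b, (a, b) ∈ s.arcs := by
  rw [← map_fst_arcs s, mem_map] at h
  obtain ⟨⟨a, b⟩, h1, rfl⟩ := h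
  exact ⟨b, h1⟩

theorem mem_of_mem_arcs {s : Cycle V} {p : V × V} (h : p ∈ s.arcs) : p.1 ∈ s := by
  rw [← map_fst_arcs s]
  exact mem_map.2 ⟨p, h, rfl⟩

theorem chain_iff_formPerm [DecidableEq V] {r : V → V → Prop} {s : Cycle V} (h : s.Nodup) :
    s.Chain r ↔ ∀ a ∈ s, r a (s.formPerm h a) := by
  rw [chain_iff_forall_mem_arcs]
  constructor
  · intro H a ha
    obtain ⟨b, hb⟩ := exists_mem_arcs ha
    have h1 := H _ hb
    rwa [← formPerm_eq_of_mem_arcs h hb] at h1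
  · intro H p hp
    rw [← formPerm_eq_of_mem_arcs h hp]
    exact H _ (mem_of_mem_arcs hp)

end Cycle

/-! ### Bonds and multiplicities of a periodic orbit -/

namespace PeriodicOrbit

variable {V : Type*} {G : Digraph V}

theorem verts_injective : Function.Injective (verts : PeriodicOrbit G → Cycle V) := by
  rintro ⟨s, _, _⟩ ⟨t, _, _⟩ h
  simpa using h

/-- The pairs of consecutive vertices of a periodic orbit, with multiplicities. -/
def arcs (γ : PeriodicOrbit G) : Multiset (V × V) := γ.verts.arcs.toMultiset

theorem card_arcs (γ : PeriodicOrbit G) : γ.arcs.card = γ.length := by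
  rw [arcs, Cycle.card_toMultiset, Cycle.length_arcs, length]

theorem mem_arcs {γ : PeriodicOrbit G} {e : V × V} : e ∈ γ.arcs ↔ e ∈ γ.verts.arcs := by
  rw [arcs]
  induction γ.verts.arcs using Quotient.inductionOn' with
  | h l => rfl

theorem nodup_arcs {γ : PeriodicOrbit G} : γ.arcs.Nodup ↔ γ.verts.arcs.Nodup := by
  rw [arcs]
  induction γ.verts.arcs using Quotient.inductionOn' with
  | h l => exact Multiset.coe_nodup

theorem adj_of_mem_arcs {γ : PeriodicOrbit G} {e : V × V} (h : e ∈ γ.arcs) : G.Adj e.1 e.2 :=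
  Cycle.chain_iff_forall_mem_arcs.1 γ.chain e (mem_arcs.1 h)

theorem length_pos (γ : PeriodicOrbit G) : 0 < γ.length := by
  rw [length, ← Cycle.card_toMultiset, Multiset.card_pos, ne_eq, Cycle.toMultiset_eq_nil]
  exact γ.ne_nil

theorem exists_mem_arcs (γ : PeriodicOrbit G) : ∃ e, e ∈ γ.arcs := by
  apply Multiset.card_pos_iff_exists_mem.1
  rw [card_arcs]
  exact γ.length_pos

theorem ne_nil_of_mem_lists {γ : PeriodicOrbit G} {x : List V} (h : x ∈ γ.verts.lists) :
    x ≠ [] := by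
  rintro rfl
  rw [Cycle.mem_lists_iff_coe_eq] at h
  exact γ.ne_nil h.symm

theorem length_of_mem_lists {γ : PeriodicOrbit G} {x : List V} (h : x ∈ γ.verts.lists) :
    x.length = γ.length := by
  rw [Cycle.mem_lists_iff_coe_eq] at h
  rw [length, ← h, Cycle.length_coe]

theorem map_lists (γ : PeriodicOrbit G) :
    γ.verts.lists.map (fun x => (x[0]?, x[1 % x.length]?)) =
      γ.arcs.map fun e => (some e.1, some e.2) := by
  rcases γ with ⟨s, hs, hc⟩
  induction s using Quotient.inductionOn' with
  | h l =>
    have hl : l ≠ [] := fun h => hs (by rw [h]; rfl)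
    exact congrArg _ (l.map_cyclicPermutations hl)

theorem countP_lists (γ : PeriodicOrbit G) (p : Option V → Option V → Prop)
    [∀ a b, Decidable (p a b)] :
    γ.verts.lists.countP (fun x => p x[0]? x[1 % x.length]?) =
      γ.arcs.countP fun e => p (some e.1) (some e.2) := by
  have h := congrArg (Multiset.countP fun e : Option V × Option V => p e.1 e.2) γ.map_lists
  rw [Multiset.countP_map, Multiset.countP_map] at h
  rw [Multiset.countP_eq_card_filter, Multiset.countP_eq_card_filter]
  exact h

theorem isPrimitive_of_mem_lists {γ : PeriodicOrbit G} (hγ : γ.IsPrimitive) {x : List V}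
    (h : x ∈ γ.verts.lists) : x.IsPrimitive := by
  rintro ⟨y, k, hk, rfl⟩
  rw [Cycle.mem_lists_iff_coe_eq] at h
  exact hγ ⟨y, k, hk, h.symm⟩

theorem IsPrimitive.nodup_lists {γ : PeriodicOrbit G} (hγ : γ.IsPrimitive) :
    γ.verts.lists.Nodup := by
  have h1 := fun x => isPrimitive_of_mem_lists (x := x) hγ
  have h2 := fun x => ne_nil_of_mem_lists (γ := γ) (x := x)
  revert h1 h2
  induction γ.verts using Quotient.inductionOn' with
  | h l =>
    intro h1 h2
    change (l.cyclicPermutations : Multiset (List V)).Nodup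
    rw [Multiset.coe_nodup]
    have hmem : ∀ x, x ~r l → x ∈ Cycle.lists (l : Cycle V) := fun x hx => by
      rw [Cycle.mem_lists_iff_coe_eq]
      exact Cycle.coe_eq_coe.2 hx
    exact List.IsPrimitive.nodup_cyclicPermutations (fun x hx => h1 x (hmem x hx))
      (h2 l (hmem l (List.IsRotated.refl l)))

/-- A `k`-fold repetition of `x` is fixed by rotation through `x.length`, which for `k ≥ 2` is less
than the total length; so bonds recur. -/
theorem isPrimitive_of_nodup_arcs {γ : PeriodicOrbit G} (h : γ.arcs.Nodup) : γ.IsPrimitive := by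
  rintro ⟨x, k, hk, hx⟩
  rw [nodup_arcs, hx, Cycle.arcs_coe, Cycle.nodup_coe_iff] at h
  set l := (List.replicate k x).flatten with hl
  have hr : l.cyclicPairs.rotate x.length = l.cyclicPairs.rotate 0 := by
    rw [← List.cyclicPairs_rotate, List.rotate_length_flatten_replicate, List.rotate_zero]
  have hne : l ≠ [] := fun h0 => γ.ne_nil (by rw [hx, h0]; rfl)
  have hlen : l.length = k * x.length := by simp [hl]
  have hpos : 0 < l.length := List.length_pos_iff.2 hne
  have hx0 : 0 < x.length := by
    rw [hlen] at hpos
    exact Nat.pos_of_mul_pos_left hpos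
  have := h.rotate_congr (by rw [← List.length_pos_iff, List.length_cyclicPairs]; exact hpos) _ _ hr
  rw [List.length_cyclicPairs, Nat.zero_mod, Nat.mod_eq_of_lt (by rw [hlen]; nlinarith)] at this
  omega

section mult

variable [DecidableEq V]

theorem mult_singleton (γ : PeriodicOrbit G) (v : V) :
    γ.mult [v] = γ.arcs.countP fun e => e.1 = v := by
  have h := γ.countP_lists fun a _ => a = some v
  simp only [Option.some.injEq] at h
  rw [← h, mult]
  refine Multiset.countP_congr rfl fun x _ => ?_
  simp

theorem mult_pair (γ : PeriodicOrbit G) (v w : V) : γ.mult [v, w] = γ.arcs.count (v, w) := by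
  have h := γ.countP_lists fun a b => a = some v ∧ b = some w
  rw [Multiset.count, mult]
  have h2 : γ.arcs.countP (fun e => (v, w) = e) =
      γ.arcs.countP fun e => some e.1 = some v ∧ some e.2 = some w := by
    refine Multiset.countP_congr rfl fun e _ => ?_
    rw [eq_comm (b := e), Prod.ext_iff]
    simp
  rw [h2, ← h]
  refine Multiset.countP_congr rfl fun x _ => ?_
  simp only [List.length_cons, List.length_nil, eq_iff_iff]
  constructor
  · intro H
    exact ⟨by simpa using H 0 (by norm_num), by simpa using H 1 (by norm_num)⟩
  · rintro ⟨h0, h1⟩ j hj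
    interval_cases j <;> simpa

end mult

end PeriodicOrbit

/-! ### Encounters of length zero and repeated bonds -/

namespace PseudoOrbit

variable {V : Type*} {G : Digraph V}

/-- The pairs of consecutive vertices of a pseudo orbit, with multiplicities. -/
def arcs (Γ : PseudoOrbit G) : Multiset (V × V) := Γ.bind PeriodicOrbit.arcs

theorem card_arcs (Γ : PseudoOrbit G) : Multiset.card Γ.arcs = Γ.length := by
  rw [arcs, Multiset.card_bind, length]
  congr 2
  funext γ
  exact γ.card_arcs

theorem isPrimitive_of_nodup_arcs {Γ : PseudoOrbit G} (h : Γ.arcs.Nodup) : Γ.IsPrimitive := by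
  induction Γ using Quotient.inductionOn with
  | h L =>
    have h' := Multiset.nodup_bind.1 h
    refine ⟨fun γ hγ => PeriodicOrbit.isPrimitive_of_nodup_arcs (h'.1 γ hγ), ?_⟩
    change (L : Multiset (PeriodicOrbit G)).Nodup
    rw [Multiset.coe_nodup]
    have hp := h'.2
    change Multiset.Pairwise _ (L : Multiset (PeriodicOrbit G)) at hp
    rw [Multiset.pairwise_coe_iff_pairwise] at hp
    refine hp.imp ?_
    rintro γ _ hd rfl
    obtain ⟨e, he⟩ := γ.exists_mem_arcs
    exact Multiset.disjoint_left.1 hd he he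

/-- All the closed walks that run through a periodic orbit of `Γ`. -/
def circuits (Γ : PseudoOrbit G) : Multiset (List V) := Γ.bind fun γ => γ.verts.lists

theorem mem_circuits {Γ : PseudoOrbit G} {x : List V} :
    x ∈ Γ.circuits ↔ ∃ γ ∈ Γ, x ∈ γ.verts.lists := Multiset.mem_bind

theorem IsPrimitive.nodup_circuits {Γ : PseudoOrbit G} (h : Γ.IsPrimitive) :
    Γ.circuits.Nodup := by
  rw [circuits, Multiset.nodup_bind]
  refine ⟨fun γ hγ => (h.1 γ hγ).nodup_lists,
    Multiset.Nodup.pairwise (fun γ _ γ' _ hne => Multiset.disjoint_left.2 ?_) h.2⟩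
  intro x hx hx'
  rw [Cycle.mem_lists_iff_coe_eq] at hx hx'
  exact hne (PeriodicOrbit.verts_injective (hx.symm.trans hx'))

theorem length_le_of_mem {Γ : PseudoOrbit G} {γ : PeriodicOrbit G} (h : γ ∈ Γ) :
    γ.length ≤ Γ.length :=
  Multiset.le_sum_of_mem (Multiset.mem_map_of_mem _ h)

section mult

variable [DecidableEq V]

theorem mult_eq_countP (Γ : PseudoOrbit G) (L : List V) :
    Γ.mult L = Γ.circuits.countP fun x => ∀ j < L.length, x[j % x.length]? = L[j]? := by
  induction Γ using Multiset.induction with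
  | empty => simp [mult, circuits]
  | cons γ Γ ih =>
    rw [circuits, Multiset.cons_bind, Multiset.countP_add, ← circuits, ← ih, mult, mult,
      Multiset.map_cons, Multiset.sum_cons, PeriodicOrbit.mult]

theorem mult_singleton (Γ : PseudoOrbit G) (v : V) :
    Γ.mult [v] = Γ.arcs.countP fun e => e.1 = v := by
  induction Γ using Multiset.induction with
  | empty => simp [mult, arcs]
  | cons γ Γ ih =>
    rw [arcs, Multiset.cons_bind, Multiset.countP_add, ← arcs, ← ih, mult, mult,
      Multiset.map_cons, Multiset.sum_cons, PeriodicOrbit.mult_singleton]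

theorem mult_pair (Γ : PseudoOrbit G) (v w : V) : Γ.mult [v, w] = Γ.arcs.count (v, w) := by
  induction Γ using Multiset.induction with
  | empty => simp [mult, arcs]
  | cons γ Γ ih =>
    rw [arcs, Multiset.cons_bind, Multiset.count_add, ← arcs, ← ih, mult, mult,
      Multiset.map_cons, Multiset.sum_cons, PeriodicOrbit.mult_pair]

theorem mult_append_le (Γ : PseudoOrbit G) (L M : List V) : Γ.mult (L ++ M) ≤ Γ.mult L := by
  rw [mult_eq_countP, mult_eq_countP, Multiset.countP_eq_card_filter,
    Multiset.countP_eq_card_filter]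
  refine Multiset.card_le_card (Multiset.monotone_filter_right _ fun x hx j hj => ?_)
  rw [hx j (by rw [List.length_append]; omega), List.getElem?_append_left hj]

theorem mult_le_one_of_nodup_arcs {Γ : PseudoOrbit G} (h : Γ.arcs.Nodup) {L : List V}
    (hL : 2 ≤ L.length) : Γ.mult L ≤ 1 := by
  rcases L with _ | ⟨v, _ | ⟨w, L⟩⟩
  · simp at hL
  · simp at hL
  · refine (Γ.mult_append_le [v, w] L).trans ?_
    rw [mult_pair]
    exact Multiset.nodup_iff_count_le_one.1 h _

/-- In a primitive pseudo orbit, two distinct circuits part before the product of their lengths. -/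
theorem IsPrimitive.length_lt_of_mult {Γ : PseudoOrbit G} (h : Γ.IsPrimitive) {L : List V}
    (hL : 2 ≤ Γ.mult L) : L.length < Γ.length * Γ.length := by
  by_contra! hlen
  rw [mult_eq_countP, Multiset.countP_eq_card_filter] at hL
  -- Since `Γ.circuits` has no repetitions, multiplicity two gives two different circuits.
  obtain ⟨x, hx, y, hy, hxy⟩ := Finset.one_lt_card.1
    (show 1 < (⟨_, h.nodup_circuits.filter _⟩ : Finset (List V)).card from hL)
  simp only [Finset.mem_mk, Multiset.mem_filter, mem_circuits] at hx hy
  obtain ⟨⟨γ, hγ, hx⟩, hx'⟩ := hx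
  obtain ⟨⟨γ', hγ', hy⟩, hy'⟩ := hy
  refine hxy (List.IsPrimitive.eq_of_repeated_eq
    (PeriodicOrbit.isPrimitive_of_mem_lists (h.1 _ hγ) hx)
    (PeriodicOrbit.isPrimitive_of_mem_lists (h.1 _ hγ') hy)
    (PeriodicOrbit.ne_nil_of_mem_lists hx) (PeriodicOrbit.ne_nil_of_mem_lists hy) fun j hj => ?_)
  have hj' : j < L.length := by
    refine lt_of_lt_of_le (lt_of_lt_of_le hj ?_) hlen
    rw [PeriodicOrbit.length_of_mem_lists hx, PeriodicOrbit.length_of_mem_lists hy]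
    exact Nat.mul_le_mul (length_le_of_mem hγ) (length_le_of_mem hγ')
  exact (hx' j hj').trans (hy' j hj').symm

/-- If all encounters have length zero, then no bond is traversed twice. -/
theorem IsPrimitive.nodup_arcs {Γ : PseudoOrbit G} (h : Γ.IsPrimitive)
    (h0 : ∀ L ∈ Γ.selfIntersections, encounterLength L = 0) : Γ.arcs.Nodup := by
  rw [Multiset.nodup_iff_count_le_one]
  rintro ⟨v, w⟩
  rw [← mult_pair]
  by_contra! hvw
  -- A sequence of maximal length in this set is an encounter: an extension of the same multiplicity
  -- would also be in the set.
  let S : Set ℕ := {m | ∃ L : List V, L.length = m ∧ 2 ≤ m ∧ 2 ≤ Γ.mult L}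
  have hne : S.Nonempty := ⟨2, [v, w], rfl, le_rfl, hvw⟩
  have hbdd : BddAbove S := by
    refine ⟨Γ.length * Γ.length, ?_⟩
    rintro _ ⟨L, rfl, _, hL⟩
    exact (h.length_lt_of_mult hL).le
  obtain ⟨L, hLm, hL2, hL⟩ := Nat.sSup_mem hne hbdd
  rw [← hLm] at hL2
  have henc : Γ.IsEncounter (Γ.mult L) L := by
    refine ⟨hL, ?_, rfl, fun L' hLL' hm => ?_⟩
    · rintro rfl
      simp at hL2
    · have : L'.length ≤ L.length := by
        rw [hLm]
        exact le_csSup hbdd ⟨L', rfl, hL2.trans hLL'.length_le, hm ▸ hL⟩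
      exact (hLL'.eq_of_length_le this).symm
  have := h0 L ⟨_, henc⟩
  rw [encounterLength] at this
  omega

theorem isEncounter_two_singleton {Γ : PseudoOrbit G} (h : Γ.arcs.Nodup) {v : V}
    (hv : Γ.mult [v] = 2) : Γ.IsEncounter 2 [v] := by
  refine ⟨le_rfl, by simp, hv, fun L hL hm => ?_⟩
  refine (hL.eq_of_length_le ?_).symm
  by_contra! hlen
  have := mult_le_one_of_nodup_arcs h (show 2 ≤ L.length from hlen)
  omega

/-- A sequence of two or more vertices contains a bond and so occurs at most once; only single
vertices can be encounters. -/
theorem selfIntersections_eq {Γ : PseudoOrbit G} (h : Γ.arcs.Nodup)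
    (h2 : ∀ v, Γ.mult [v] ≤ 2) :
    Γ.selfIntersections = (fun v => [v]) '' {v | Γ.mult [v] = 2} := by
  ext L
  constructor
  · rintro ⟨r, hr, hL, hm, -⟩
    rcases L with _ | ⟨v, _ | ⟨w, L⟩⟩
    · exact absurd rfl hL
    · exact ⟨v, le_antisymm (h2 v) (hm ▸ hr), rfl⟩
    · have := mult_le_one_of_nodup_arcs h (L := v :: w :: L) (by simp)
      omega
  · rintro ⟨v, hv, rfl⟩
    exact ⟨2, isEncounter_two_singleton h hv⟩

theorem mult_le_two {Γ : PseudoOrbit G} (h : Γ.arcs.Nodup)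
    (hG : ∀ v, ∃ a b, ∀ w, G.Adj v w → w = a ∨ w = b) (v : V) : Γ.mult [v] ≤ 2 := by
  rw [mult_singleton, Multiset.countP_eq_card_filter]
  obtain ⟨a, b, hab⟩ := hG v
  have hsub : (⟨_, h.filter fun e => e.1 = v⟩ : Finset (V × V)) ⊆ {(v, a), (v, b)} := by
    rintro ⟨x, w⟩ hx
    simp only [Finset.mem_mk, Multiset.mem_filter] at hx
    obtain ⟨hx, rfl⟩ := hx
    obtain ⟨γ, -, hγ⟩ := Multiset.mem_bind.1 hx
    rcases hab w (PeriodicOrbit.adj_of_mem_arcs hγ) with rfl | rfl <;> simp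
  exact (Finset.card_le_card hsub).trans Finset.card_le_two

theorem mem_primitivePseudoOrbits [Finite V]
    (hG : ∀ v, ∃ a b, ∀ w, G.Adj v w → w = a ∨ w = b) {Γ : PseudoOrbit G} {l N : ℕ} :
    Γ ∈ primitivePseudoOrbits G l N ↔
      Γ.arcs.Nodup ∧ Multiset.card Γ.arcs = l ∧
        {v | (Γ.arcs.countP fun e => e.1 = v) = 2}.ncard = N := by
  have hcard : ∀ h : Γ.arcs.Nodup,
      Γ.selfIntersections.ncard = {v | (Γ.arcs.countP fun e => e.1 = v) = 2}.ncard := by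
    intro h
    rw [selfIntersections_eq h (mult_le_two h hG),
      Set.ncard_image_of_injective _ (fun a b => by simp)]
    simp only [mult_singleton]
  constructor
  · rintro ⟨hp, hl, -, hN, h0⟩
    have hnd := hp.nodup_arcs fun L hL => (h0 L hL).2
    exact ⟨hnd, by rw [card_arcs, hl], by rw [← hcard hnd, hN]⟩
  · rintro ⟨hnd, hl, hN⟩
    refine ⟨isPrimitive_of_nodup_arcs hnd, by rw [← card_arcs, hl], ?_, by rw [hcard hnd, hN], ?_⟩
    · rw [selfIntersections_eq hnd (mult_le_two hnd hG)]
      exact Set.toFinite _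
    · rw [selfIntersections_eq hnd (mult_le_two hnd hG)]
      rintro _ ⟨v, hv, rfl⟩
      exact ⟨isEncounter_two_singleton hnd hv, rfl⟩

end mult

end PseudoOrbit

/-! ### Pseudo orbits as permutations of bonds -/

/-- Permutations of the pairs of vertices which map each pair that they move, which has to be a
bond, to a pair that starts where the former ends. -/
def IsOrbitPerm {V : Type*} (G : Digraph V) (π : Equiv.Perm (V × V)) : Prop :=
  ∀ e, π e ≠ e → G.Adj e.1 e.2 ∧ (π e).1 = e.2

namespace PeriodicOrbit

variable {V : Type*} {G : Digraph V}

open Classical in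
/-- The permutation that maps each bond of a periodic orbit without repeated bonds to the next. -/
noncomputable def perm [DecidableEq V] (γ : PeriodicOrbit G) : Equiv.Perm (V × V) :=
  if h : γ.verts.arcs.Nodup then γ.verts.arcs.formPerm h else 1

/-- An orbit with one bond would be a loop. Such orbits must be excluded since `formPerm` turns them
into the identity and forgets them. -/
theorem nontrivial_arcs (hG : ∀ v, ¬G.Adj v v) {γ : PeriodicOrbit G} (h : γ.arcs.Nodup) :
    γ.verts.arcs.Nontrivial := by
  rw [(nodup_arcs.1 h).nontrivial_iff, Cycle.length_subsingleton_iff, Cycle.length_arcs]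
  have hpos := γ.length_pos
  have hc := γ.chain
  rw [length] at hpos
  revert hpos hc
  induction γ.verts using Quotient.inductionOn' with
  | h l =>
    intro hpos hc hle
    rcases l with _ | ⟨v, _ | ⟨w, l⟩⟩
    · exact absurd hpos (lt_irrefl 0)
    · exact hG v ((Cycle.chain_singleton _ _).1 hc)
    · have : l.length + 1 + 1 ≤ 1 := hle
      omega

variable [DecidableEq V]

theorem perm_eq {γ : PeriodicOrbit G} (h : γ.arcs.Nodup) :
    γ.perm = γ.verts.arcs.formPerm (nodup_arcs.1 h) := dif_pos _

theorem isCycle_perm (hG : ∀ v, ¬G.Adj v v) {γ : PeriodicOrbit G} (h : γ.arcs.Nodup) :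
    γ.perm.IsCycle := by
  rw [perm_eq h]
  exact Cycle.isCycle_formPerm _ _ (nontrivial_arcs hG h)

theorem perm_apply_fst {γ : PeriodicOrbit G} (h : γ.arcs.Nodup) {e : V × V} (he : e ∈ γ.arcs) :
    (γ.perm e).1 = e.2 := by
  rw [perm_eq h]
  exact (Cycle.chain_iff_formPerm (nodup_arcs.1 h)).1 γ.verts.chain_arcs e (mem_arcs.1 he)

theorem perm_injOn (hG : ∀ v, ¬G.Adj v v) {γ γ' : PeriodicOrbit G} (h : γ.arcs.Nodup)
    (h' : γ'.arcs.Nodup) (he : γ.perm = γ'.perm) : γ = γ' := by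
  rw [perm_eq h, perm_eq h', Cycle.formPerm_eq_formPerm_iff] at he
  rcases he with he | ⟨hs, -⟩
  · apply verts_injective
    rw [← γ.verts.map_fst_arcs, he, Cycle.map_fst_arcs]
  · exact absurd hs ((nodup_arcs.1 h).nontrivial_iff.1 (nontrivial_arcs hG h))

variable [Fintype V]

theorem support_perm_val (hG : ∀ v, ¬G.Adj v v) {γ : PeriodicOrbit G} (h : γ.arcs.Nodup) :
    γ.perm.support.val = γ.arcs := by
  rw [Multiset.Nodup.ext γ.perm.support.nodup h]
  intro e
  rw [perm_eq h, Cycle.support_formPerm _ _ (nontrivial_arcs hG h), ← Cycle.toFinset_toMultiset,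
    Finset.mem_val, Multiset.mem_toFinset, arcs]

theorem mem_support_perm (hG : ∀ v, ¬G.Adj v v) {γ : PeriodicOrbit G} (h : γ.arcs.Nodup)
    {e : V × V} : e ∈ γ.perm.support ↔ e ∈ γ.arcs := by
  rw [← Finset.mem_val, support_perm_val hG h]

theorem exists_perm_eq {c : Equiv.Perm (V × V)} (hc : c.IsCycle) (h : IsOrbitPerm G c) :
    ∃ γ : PeriodicOrbit G, γ.arcs.Nodup ∧ γ.perm = c := by
  have hnd := c.nodup_toCycle hc
  have hform : (c.toCycle hc).formPerm hnd = c :=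
    congrArg Subtype.val (Equiv.Perm.isoCycle.left_inv ⟨c, hc⟩)
  have hch : (c.toCycle hc).Chain fun e e' => e'.1 = e.2 := by
    rw [Cycle.chain_iff_formPerm hnd]
    intro e he
    rw [hform]
    exact (h e ((c.mem_toCycle_iff_support hc).1 he)).2
  have harcs := Cycle.arcs_map_fst hch
  let γ : PeriodicOrbit G := ⟨(c.toCycle hc).map Prod.fst, by
    rw [ne_eq, Cycle.map_eq_nil]
    intro h0
    have := Cycle.length_nontrivial (c.nontrivial_toCycle hc)
    rw [h0, Cycle.length_nil] at this
    omega, by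
    rw [Cycle.chain_iff_forall_mem_arcs, harcs]
    intro e he
    exact (h e ((c.mem_toCycle_iff_support hc).1 he)).1⟩
  have hγ : γ.verts.arcs = c.toCycle hc := harcs
  have hn : γ.arcs.Nodup := by rw [nodup_arcs, hγ]; exact hnd
  refine ⟨γ, hn, ?_⟩
  rw [perm_eq hn]
  conv_rhs => rw [← hform]
  congr 1

end PeriodicOrbit

theorem Multiset.exists_map_eq_of_forall {α β : Type*} {f : α → β} {p : α → Prop} (s : Multiset β)
    (h : ∀ b ∈ s, ∃ a, p a ∧ f a = b) : ∃ t : Multiset α, (∀ a ∈ t, p a) ∧ t.map f = s := by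
  induction s using Multiset.induction with
  | empty => exact ⟨0, by simp⟩
  | cons b s ih =>
    obtain ⟨t, ht, rfl⟩ := ih fun b hb => h b (Multiset.mem_cons_of_mem hb)
    obtain ⟨a, ha, rfl⟩ := h b (Multiset.mem_cons_self _ _)
    exact ⟨a ::ₘ t, by simpa using ⟨ha, ht⟩, by simp⟩

/-- Injectivity is asked only between members, because `perm` is injective only on orbits without
repeated bonds. -/
theorem Multiset.eq_of_map_eq_map {α β : Type*} {f : α → β} {s t : Multiset α}
    (hf : ∀ a ∈ s, ∀ b ∈ t, f a = f b → a = b) (h : s.map f = t.map f) : s = t := by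
  induction s using Multiset.induction generalizing t with
  | empty => exact (Multiset.map_eq_zero.1 (h.symm.trans (Multiset.map_zero f))).symm
  | cons a s ih =>
    have ha : f a ∈ t.map f := by rw [← h]; simp
    obtain ⟨b, hb, hab⟩ := Multiset.mem_map.1 ha
    obtain rfl := hf a (Multiset.mem_cons_self _ _) b hb hab.symm
    obtain ⟨t, rfl⟩ := Multiset.exists_cons_of_mem hb
    rw [Multiset.map_cons, Multiset.map_cons, Multiset.cons_inj_right] at h
    rw [ih (fun x hx y hy => hf x (Multiset.mem_cons_of_mem hx) y (Multiset.mem_cons_of_mem hy)) h]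

theorem Equiv.Perm.bind_support_cycleFactorsFinset {α : Type*} [Fintype α] [DecidableEq α]
    (π : Equiv.Perm α) :
    (π.cycleFactorsFinset.val.bind fun c => c.support.val) = π.support.val := by
  have hd : (π.cycleFactorsFinset : Set (Equiv.Perm α)).PairwiseDisjoint Equiv.Perm.support :=
    fun a ha b hb hab => Equiv.Perm.disjoint_iff_disjoint_support.1
      (π.cycleFactorsFinset_pairwise_disjoint ha hb hab)
  rw [← Finset.disjiUnion_val _ _ hd]
  congr 1
  ext e
  rw [Finset.mem_disjiUnion,
    Equiv.Perm.mem_support_iff_mem_support_of_mem_cycleFactorsFinset]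

namespace PseudoOrbit

variable {V : Type*} [DecidableEq V] [Fintype V] {G : Digraph V}

/-- The orbits of `Γ` are the cycles of the permutation `π` of the bonds. -/
def HasPerm (Γ : PseudoOrbit G) (π : Equiv.Perm (V × V)) : Prop :=
  (∀ γ ∈ Γ, γ.arcs.Nodup) ∧ Γ.map PeriodicOrbit.perm = π.cycleFactorsFinset.val

theorem HasPerm.arcs_eq (hG : ∀ v, ¬G.Adj v v) {Γ : PseudoOrbit G} {π : Equiv.Perm (V × V)}
    (h : Γ.HasPerm π) : Γ.arcs = π.support.val := by
  rw [← π.bind_support_cycleFactorsFinset, ← h.2, Multiset.bind_map, arcs]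
  exact Multiset.bind_congr fun γ hγ => (PeriodicOrbit.support_perm_val hG (h.1 γ hγ)).symm

theorem HasPerm.left_unique (hG : ∀ v, ¬G.Adj v v) {Γ Γ' : PseudoOrbit G}
    {π : Equiv.Perm (V × V)} (h : Γ.HasPerm π) (h' : Γ'.HasPerm π) : Γ = Γ' :=
  Multiset.eq_of_map_eq_map
    (fun γ hγ γ' hγ' => PeriodicOrbit.perm_injOn hG (h.1 γ hγ) (h'.1 γ' hγ')) (h.2.trans h'.2.symm)

theorem HasPerm.right_unique {Γ : PseudoOrbit G} {π π' : Equiv.Perm (V × V)} (h : Γ.HasPerm π)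
    (h' : Γ.HasPerm π') : π = π' :=
  Equiv.Perm.cycleFactorsFinset_injective (Finset.val_injective (h.2.symm.trans h'.2))

theorem HasPerm.isOrbitPerm (hG : ∀ v, ¬G.Adj v v) {Γ : PseudoOrbit G} {π : Equiv.Perm (V × V)}
    (h : Γ.HasPerm π) : IsOrbitPerm G π := by
  intro e he
  obtain ⟨c, hc, hec⟩ :=
    (π.mem_support_iff_mem_support_of_mem_cycleFactorsFinset).1 (Equiv.Perm.mem_support.2 he)
  have hcΓ : c ∈ Γ.map PeriodicOrbit.perm := by rw [h.2]; exact hc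
  obtain ⟨γ, hγ, rfl⟩ := Multiset.mem_map.1 hcΓ
  rw [← (Equiv.Perm.mem_cycleFactorsFinset_iff.1 hc).2 e hec]
  rw [PeriodicOrbit.mem_support_perm hG (h.1 γ hγ)] at hec
  exact ⟨PeriodicOrbit.adj_of_mem_arcs hec, PeriodicOrbit.perm_apply_fst (h.1 γ hγ) hec⟩

theorem exists_hasPerm_of_isOrbitPerm {π : Equiv.Perm (V × V)} (h : IsOrbitPerm G π) :
    ∃ Γ : PseudoOrbit G, Γ.HasPerm π := by
  refine Multiset.exists_map_eq_of_forall _ fun c hc => ?_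
  have hc' := Equiv.Perm.mem_cycleFactorsFinset_iff.1 hc
  refine PeriodicOrbit.exists_perm_eq hc'.1 fun e he => ?_
  have hce := hc'.2 e (Equiv.Perm.mem_support.2 he)
  rw [hce]
  exact h e (hce ▸ he)

/-- Orbits sharing no bond give disjoint cycles, whose product is the permutation sought. -/
theorem exists_hasPerm_of_nodup_arcs (hG : ∀ v, ¬G.Adj v v) {Γ : PseudoOrbit G}
    (h : Γ.arcs.Nodup) : ∃ π, Γ.HasPerm π := by
  induction Γ using Quotient.inductionOn with
  | h L =>
    have h' := Multiset.nodup_bind.1 h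
    have hnd : ∀ γ ∈ L, γ.arcs.Nodup := fun γ hγ => h'.1 γ hγ
    have hp := h'.2
    change Multiset.Pairwise _ (L : Multiset (PeriodicOrbit G)) at hp
    rw [Multiset.pairwise_coe_iff_pairwise] at hp
    have hcyc : ∀ c ∈ L.map PeriodicOrbit.perm, c.IsCycle := by
      intro c hc
      obtain ⟨γ, hγ, rfl⟩ := List.mem_map.1 hc
      exact PeriodicOrbit.isCycle_perm hG (hnd γ hγ)
    have hdis : (L.map PeriodicOrbit.perm).Pairwise Equiv.Perm.Disjoint := by
      rw [List.pairwise_map]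
      refine hp.imp_of_mem fun {γ γ'} hγ hγ' hd => ?_
      rw [Equiv.Perm.disjoint_iff_disjoint_support, Finset.disjoint_left]
      intro e he he'
      rw [PeriodicOrbit.mem_support_perm hG (hnd _ hγ)] at he
      rw [PeriodicOrbit.mem_support_perm hG (hnd _ hγ')] at he'
      exact Multiset.disjoint_left.1 hd he he'
    have hl := Equiv.Perm.nodup_of_pairwise_disjoint_cycles hcyc hdis
    refine ⟨(L.map PeriodicOrbit.perm).prod, hnd, ?_⟩
    rw [(Equiv.Perm.cycleFactorsFinset_eq_list_toFinset hl).2 ⟨hcyc, hdis, rfl⟩]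
    rw [List.toFinset_val, hl.dedup]
    rfl

/-- The primitive pseudo orbits whose self-intersections are 2-encounters of length zero correspond
to permutations of bonds. -/
theorem bijOn_hasPerm (hG : ∀ v, ¬G.Adj v v)
    (hG2 : ∀ v, ∃ a b, ∀ w, G.Adj v w → w = a ∨ w = b) (l N : ℕ) :
    ∃ f : PseudoOrbit G → Equiv.Perm (V × V), Set.BijOn f (primitivePseudoOrbits G l N)
      {π | IsOrbitPerm G π ∧ π.support.card = l ∧
        (Finset.univ.filter fun v => (π.support.filter fun e => e.1 = v).card = 2).card = N} := by
  classical
  have hiff : ∀ (Γ : PseudoOrbit G) (π : Equiv.Perm (V × V)), Γ.HasPerm π →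
      (Γ ∈ primitivePseudoOrbits G l N ↔ IsOrbitPerm G π ∧ π.support.card = l ∧
        (Finset.univ.filter fun v => (π.support.filter fun e => e.1 = v).card = 2).card = N) := by
    intro Γ π h
    have h1 := h.arcs_eq hG
    rw [mem_primitivePseudoOrbits hG2, h1]
    simp only [π.support.nodup, h.isOrbitPerm hG, true_and, Finset.card_val]
    have hset : {v | (π.support.val.countP fun e => e.1 = v) = 2}.ncard =
        (Finset.univ.filter fun v => (π.support.filter fun e => e.1 = v).card = 2).card := by
      rw [← Set.ncard_coe_finset]
      simp only [Finset.coe_filter, Finset.mem_univ, true_and, Multiset.countP_eq_card_filter]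
      rfl
    rw [hset]
  have hex : ∀ Γ ∈ primitivePseudoOrbits G l N, ∃ π, Γ.HasPerm π := fun Γ hΓ =>
    exists_hasPerm_of_nodup_arcs hG ((mem_primitivePseudoOrbits hG2).1 hΓ).1
  choose! f hf using hex
  refine ⟨f, fun Γ hΓ => (hiff Γ _ (hf Γ hΓ)).1 hΓ, fun Γ hΓ Γ' hΓ' he => ?_, fun π hπ => ?_⟩
  · have := hf Γ hΓ
    rw [he] at this
    exact this.left_unique hG (hf Γ' hΓ')
  · obtain ⟨Γ, hΓ⟩ := exists_hasPerm_of_isOrbitPerm hπ.1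
    have hmem := (hiff Γ π hΓ).2 hπ
    exact ⟨Γ, hmem, (hf Γ hmem).right_unique hΓ⟩

end PseudoOrbit

/-! ### Counting permutations over balanced sets of bonds -/

/-- Matching the fibres of `g` with those of `f` gives one solution `σ₀`; the others differ from it
by permutations preserving `f`, which permute each fibre freely. -/
theorem card_perm_fiber {α ι : Type*} [Fintype α] [DecidableEq α] [Fintype ι] [DecidableEq ι]
    (f g : α → ι)
    (h : ∀ i, (Finset.univ.filter fun a => g a = i).card =
      (Finset.univ.filter fun a => f a = i).card) :
    (Finset.univ.filter fun σ : Equiv.Perm α => ∀ a, f (σ a) = g a).card =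
      ∏ i, ((Finset.univ.filter fun a => f a = i).card).factorial := by
  obtain ⟨σ₀, h₀⟩ : ∃ σ : Equiv.Perm α, ∀ a, f (σ a) = g a := by
    have e : ∀ i, Nonempty ({a // g a = i} ≃ {a // f a = i}) := fun i => by
      rw [← Fintype.card_eq, Fintype.card_subtype, Fintype.card_subtype, h i]
    replace e := fun i => (e i).some
    refine ⟨(Equiv.sigmaFiberEquiv g).symm.trans
      ((Equiv.sigmaCongrRight e).trans (Equiv.sigmaFiberEquiv f)), fun a => ?_⟩
    exact (e (g a) ⟨a, rfl⟩).2
  have h1 := DomMulAct.stabilizer_card f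
  simp only [Fintype.card_subtype] at h1
  rw [← h1]
  refine Finset.card_nbij' (fun σ => σ * σ₀⁻¹) (fun σ => σ * σ₀) ?_ ?_ ?_ ?_
  · intro σ hσ
    simp only [Finset.coe_filter, Finset.mem_univ, true_and, Set.mem_ofPred_eq] at hσ ⊢
    funext a
    simp [hσ, ← h₀]
  · intro σ hσ
    simp only [Finset.coe_filter, Finset.mem_univ, true_and, Set.mem_ofPred_eq] at hσ ⊢
    intro a
    rw [← h₀ a]
    exact congrFun hσ (σ₀ a)
  · intro σ _
    simp
  · intro σ _
    simp

theorem card_filter_fst_le_two {V : Type*} [DecidableEq V] {G : Digraph V}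
    (hG2 : ∀ v, ∃ a b, ∀ w, G.Adj v w → w = a ∨ w = b)
    {E : Finset (V × V)} (hE : ∀ e ∈ E, G.Adj e.1 e.2) (v : V) :
    (E.filter fun e => e.1 = v).card ≤ 2 := by
  obtain ⟨a, b, hab⟩ := hG2 v
  refine (Finset.card_le_card (t := {(v, a), (v, b)}) ?_).trans Finset.card_le_two
  rintro ⟨x, w⟩ hx
  simp only [Finset.mem_filter] at hx
  obtain ⟨hx, rfl⟩ := hx
  rcases hab w (hE _ hx) with rfl | rfl <;> simp

section

variable {V : Type*} [Fintype V] [DecidableEq V]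

/-- The number of permutations that move exactly the pairs in `E`, each to a pair in `E` that
starts where the former ends. -/
theorem card_perm_of_balanced (E : Finset (V × V)) (hE : ∀ e ∈ E, e.1 ≠ e.2)
    (h : ∀ v, (E.filter fun e => e.2 = v).card = (E.filter fun e => e.1 = v).card) :
    (Finset.univ.filter fun π : Equiv.Perm (V × V) =>
      π.support = E ∧ ∀ e ∈ E, (π e).1 = e.2).card =
      ∏ v, ((E.filter fun e => e.1 = v).card).factorial := by
  have hcard : ∀ (p : V × V → Prop) [DecidablePred p],
      (Finset.univ.filter fun e : {e // e ∈ E} => p e).card = (E.filter p).card := by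
    intro p _
    rw [← Finset.card_map (Function.Embedding.subtype _)]
    congr 1
    ext e
    simp only [Finset.mem_map, Finset.mem_filter, Finset.mem_univ, true_and,
      Function.Embedding.subtype_apply]
    exact ⟨fun ⟨a, ha, hae⟩ => hae ▸ ⟨a.2, ha⟩, fun he => ⟨⟨e, he.1⟩, he.2, rfl⟩⟩
  have h1 := card_perm_fiber (fun e : {e // e ∈ E} => e.1.1) (fun e : {e // e ∈ E} => e.1.2)
    (fun v => by rw [hcard fun e => e.2 = v, hcard fun e => e.1 = v, h v])
  rw [← Finset.prod_congr rfl fun v _ => congrArg Nat.factorial (hcard fun e => e.1 = v), ← h1]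
  symm
  refine Finset.card_bij (fun g _ => Equiv.Perm.ofSubtype g) ?_ ?_ ?_
  · intro g hg
    simp only [Finset.mem_filter, Finset.mem_univ, true_and] at hg ⊢
    have h2 : ∀ e (he : e ∈ E), Equiv.Perm.ofSubtype g e = (g ⟨e, he⟩ : V × V) := fun e he =>
      Equiv.Perm.ofSubtype_apply_of_mem g he
    refine ⟨?_, fun e he => by rw [h2 e he]; exact hg ⟨e, he⟩⟩
    ext e
    rw [Equiv.Perm.mem_support]
    by_cases he : e ∈ E
    · simp only [he, iff_true]
      -- A fixed pair would start where it ends, against `hE`.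
      intro h3
      apply hE e he
      have := hg ⟨e, he⟩
      rw [← h2 e he, h3] at this
      exact this
    · simp only [he, iff_false, not_not]
      exact Equiv.Perm.ofSubtype_apply_of_not_mem g he
  · intro g _ g' _ hgg
    exact Equiv.Perm.ofSubtype_injective hgg
  · intro π hπ
    simp only [Finset.mem_filter, Finset.mem_univ, true_and] at hπ
    obtain ⟨rfl, hπ⟩ := hπ
    refine ⟨π.subtypePerm fun e => Equiv.Perm.apply_mem_support, ?_, ?_⟩
    · simp only [Finset.mem_filter, Finset.mem_univ, true_and]
      exact fun e => hπ e e.2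
    · exact Equiv.Perm.ofSubtype_subtypePerm _ fun e he => Equiv.Perm.mem_support.2 he

open Classical in
/-- The sets of `l` bonds of `G` that have as many bonds ending as starting at each vertex, with
exactly `N` vertices at which two bonds start. -/
noncomputable def balancedSets (G : Digraph V) (l N : ℕ) : Finset (Finset (V × V)) :=
  Finset.univ.filter fun E => (∀ e ∈ E, G.Adj e.1 e.2) ∧
    (∀ v, (E.filter fun e => e.2 = v).card = (E.filter fun e => e.1 = v).card) ∧ E.card = l ∧
    (Finset.univ.filter fun v => (E.filter fun e => e.1 = v).card = 2).card = N

variable {G : Digraph V} {l N : ℕ}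

theorem mem_balancedSets {E : Finset (V × V)} : E ∈ balancedSets G l N ↔
    (∀ e ∈ E, G.Adj e.1 e.2) ∧
    (∀ v, (E.filter fun e => e.2 = v).card = (E.filter fun e => e.1 = v).card) ∧ E.card = l ∧
    (Finset.univ.filter fun v => (E.filter fun e => e.1 = v).card = 2).card = N := by
  simp [balancedSets]

/-- The permutation itself maps the bonds ending at `v` bijectively onto those starting there. -/
theorem IsOrbitPerm.balanced {π : Equiv.Perm (V × V)} (h : IsOrbitPerm G π) (v : V) :
    (π.support.filter fun e => e.2 = v).card = (π.support.filter fun e => e.1 = v).card := by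
  refine Finset.card_nbij' π π.symm ?_ ?_ ?_ ?_
  · intro e he
    simp only [Finset.coe_filter, Set.mem_ofPred_eq] at he ⊢
    refine ⟨Equiv.Perm.apply_mem_support.2 he.1, ?_⟩
    rw [(h e (Equiv.Perm.mem_support.1 he.1)).2, he.2]
  · intro e he
    simp only [Finset.coe_filter, Set.mem_ofPred_eq] at he ⊢
    have hs : π.symm e ∈ π.support := by
      rw [← Equiv.Perm.apply_mem_support, Equiv.apply_symm_apply]
      exact he.1
    refine ⟨hs, ?_⟩
    rw [← (h _ (Equiv.Perm.mem_support.1 hs)).2, Equiv.apply_symm_apply, he.2]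
  · intro e _
    simp
  · intro e _
    simp

/-- The number of primitive pseudo orbits in terms of the sets of bonds that they traverse. -/
theorem finite_and_ncard_primitivePseudoOrbits (hG : ∀ v, ¬G.Adj v v)
    (hG2 : ∀ v, ∃ a b, ∀ w, G.Adj v w → w = a ∨ w = b) :
    (primitivePseudoOrbits G l N).Finite ∧
      (primitivePseudoOrbits G l N).ncard = 2 ^ N * (balancedSets G l N).card := by
  classical
  obtain ⟨f, hf⟩ := PseudoOrbit.bijOn_hasPerm hG hG2 l N
  refine ⟨hf.finite_iff_finite.2 (Set.toFinite _), ?_⟩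
  rw [← hf.injOn.ncard_image, hf.image_eq]
  set P : Finset (Equiv.Perm (V × V)) := Finset.univ.filter fun π =>
    IsOrbitPerm G π ∧ π.support.card = l ∧
      (Finset.univ.filter fun v => (π.support.filter fun e => e.1 = v).card = 2).card = N with hP
  have hPs : {π | IsOrbitPerm G π ∧ π.support.card = l ∧
      (Finset.univ.filter fun v => (π.support.filter fun e => e.1 = v).card = 2).card = N} =
      (P : Set (Equiv.Perm (V × V))) := by
    ext; simp [hP]
  rw [hPs, Set.ncard_coe_finset]
  have hmaps : ∀ π ∈ P, π.support ∈ balancedSets G l N := by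
    intro π hπ
    simp only [hP, Finset.mem_filter, Finset.mem_univ, true_and] at hπ
    rw [mem_balancedSets]
    exact ⟨fun e he => (hπ.1 e (Equiv.Perm.mem_support.1 he)).1, hπ.1.balanced, hπ.2⟩
  rw [Finset.card_eq_sum_card_fiberwise hmaps, mul_comm, ← smul_eq_mul, ← Finset.sum_const]
  refine Finset.sum_congr rfl fun E hE => ?_
  rw [mem_balancedSets] at hE
  obtain ⟨hadj, hbal, hl, hN⟩ := hE
  have h1 := card_perm_of_balanced E (fun e he h0 => hG e.1 (by
    have := hadj e he; rwa [← h0] at this)) hbal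
  -- The factors are 0!, 1! or 2!; only the `N` vertices with two outgoing bonds contribute a 2.
  have h2 : ∏ v, ((E.filter fun e => e.1 = v).card).factorial = 2 ^ N := by
    rw [← hN, ← Finset.prod_const, Finset.prod_filter]
    refine Finset.prod_congr rfl fun v _ => ?_
    have := card_filter_fst_le_two hG2 hadj v
    interval_cases (E.filter fun e => e.1 = v).card <;> simp
  rw [← h2, ← h1]
  congr 1
  ext π
  simp only [hP, Finset.mem_filter, Finset.mem_univ, true_and]
  constructor
  · rintro ⟨⟨h, -⟩, rfl⟩
    exact ⟨rfl, fun e he => (h e (Equiv.Perm.mem_support.1 he)).2⟩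
  · rintro ⟨rfl, h⟩
    exact ⟨⟨fun e he => ⟨hadj e (Equiv.Perm.mem_support.2 he), h e (Equiv.Perm.mem_support.2 he)⟩,
      hl, hN⟩, rfl⟩

end

/-! ### Balanced sets of bonds in the circulant graph -/

section circulant

variable {n : ℕ}

theorem ZMod.natCast_ne_zero_of_lt {a : ℕ} (ha : 0 < a) (han : a < n) : (a : ZMod n) ≠ 0 := by
  rw [ne_eq, ZMod.natCast_eq_zero_iff]
  exact fun h => absurd (Nat.le_of_dvd ha h) (by omega)

theorem circulantDigraph_one_three_adj {v w : ZMod n} :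
    (circulantDigraph n {1, 3}).Adj v w ↔ w = v + 1 ∨ w = v + 3 := by
  simp [circulantDigraph]

theorem not_circulantDigraph_adj_self (hn : 3 < n) (v : ZMod n) :
    ¬(circulantDigraph n {1, 3}).Adj v v := by
  rw [circulantDigraph_one_three_adj]
  have h1 := ZMod.natCast_ne_zero_of_lt (n := n) one_pos (by omega)
  have h3 := ZMod.natCast_ne_zero_of_lt (n := n) (a := 3) (by norm_num) hn
  push_cast at h1 h3
  rintro (h | h)
  · exact h1 (left_eq_add.1 h)
  · exact h3 (left_eq_add.1 h)

/-- Whether the bond from `v` to `v + a` belongs to `E`. -/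
def hasArc (E : Finset (ZMod n × ZMod n)) (a v : ZMod n) : Bool := decide ((v, v + a) ∈ E)

theorem card_filter_fst_eq (hn : 3 < n) {E : Finset (ZMod n × ZMod n)}
    (hE : ∀ e ∈ E, (circulantDigraph n {1, 3}).Adj e.1 e.2) (v : ZMod n) :
    (E.filter fun e => e.1 = v).card = (hasArc E 1 v).toNat + (hasArc E 3 v).toNat := by
  have h2 := ZMod.natCast_ne_zero_of_lt (n := n) (a := 2) (by norm_num) (by omega)
  push_cast at h2
  have h13 : ((v, v + 1) : ZMod n × ZMod n) ≠ (v, v + 3) := by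
    intro h
    apply h2
    simp only [Prod.mk.injEq, true_and] at h
    linear_combination -h
  have hset : (E.filter fun e => e.1 = v) =
      ({(v, v + 1), (v, v + 3)} : Finset (ZMod n × ZMod n)).filter (· ∈ E) := by
    ext ⟨a, w⟩
    simp only [Finset.mem_filter, Finset.mem_insert, Finset.mem_singleton, Prod.mk.injEq]
    constructor
    · rintro ⟨h, rfl⟩
      exact ⟨(circulantDigraph_one_three_adj.1 (hE _ h)).imp (⟨rfl, ·⟩) (⟨rfl, ·⟩), h⟩
    · rintro ⟨h | h, h'⟩ <;> exact ⟨h', h.1⟩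
  rw [hset, Finset.card_filter, Finset.sum_pair h13]
  by_cases h : (v, v + 1) ∈ E <;> by_cases h' : (v, v + 3) ∈ E <;> simp [hasArc, h, h']

theorem card_filter_snd_eq (hn : 3 < n) {E : Finset (ZMod n × ZMod n)}
    (hE : ∀ e ∈ E, (circulantDigraph n {1, 3}).Adj e.1 e.2) (v : ZMod n) :
    (E.filter fun e => e.2 = v).card =
      (hasArc E 1 (v - 1)).toNat + (hasArc E 3 (v - 3)).toNat := by
  have h2 := ZMod.natCast_ne_zero_of_lt (n := n) (a := 2) (by norm_num) (by omega)
  push_cast at h2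
  have h13 : ((v - 1, v) : ZMod n × ZMod n) ≠ (v - 3, v) := by
    intro h
    apply h2
    simp only [Prod.mk.injEq, and_true] at h
    linear_combination h
  have hset : (E.filter fun e => e.2 = v) =
      ({(v - 1, v), (v - 3, v)} : Finset (ZMod n × ZMod n)).filter (· ∈ E) := by
    ext ⟨a, w⟩
    simp only [Finset.mem_filter, Finset.mem_insert, Finset.mem_singleton, Prod.mk.injEq]
    constructor
    · rintro ⟨h, rfl⟩
      exact ⟨(circulantDigraph_one_three_adj.1 (hE _ h)).imp
        (fun h => ⟨eq_sub_of_add_eq h.symm, rfl⟩) (fun h => ⟨eq_sub_of_add_eq h.symm, rfl⟩), h⟩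
    · rintro ⟨h | h, h'⟩ <;> exact ⟨h', h.2⟩
  rw [hset, Finset.card_filter, Finset.sum_pair h13]
  by_cases h : (v - 1, v) ∈ E <;> by_cases h' : (v - 3, v) ∈ E <;> simp [hasArc, h, h']

variable [NeZero n]

theorem card_eq_sum_hasArc (hn : 3 < n) {E : Finset (ZMod n × ZMod n)}
    (hE : ∀ e ∈ E, (circulantDigraph n {1, 3}).Adj e.1 e.2) :
    E.card = ∑ v, (hasArc E 1 v).toNat + ∑ v, (hasArc E 3 v).toNat := by
  rw [Finset.card_eq_sum_card_fiberwise (f := Prod.fst) (t := Finset.univ) (by simp),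
    ← Finset.sum_add_distrib]
  exact Finset.sum_congr rfl fun v _ => card_filter_fst_eq hn hE v

theorem sum_window (y : ZMod n → ℕ) :
    ∑ v, (y v + y (v - 1) + y (v - 2)) = 3 * ∑ v, y v := by
  have h : ∀ c : ZMod n, ∑ v, y (v - c) = ∑ v, y v := fun c => (Equiv.subRight c).sum_comp y
  rw [Finset.sum_add_distrib, Finset.sum_add_distrib, h, h]
  ring

theorem card_filter_false_add_sum (y : ZMod n → Bool) :
    (Finset.univ.filter fun v => y v = false).card + ∑ v, (y v).toNat = n := by
  rw [Finset.card_filter, ← Finset.sum_add_distrib]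
  have : ∀ v, (if y v = false then 1 else 0) + (y v).toNat = 1 := by
    intro v
    cases y v <;> simp
  simp [this]

/-- The number of bonds of a balanced set that cross a cut of the circle is the same for all
cuts; it is two if the set is small and has a vertex at which two bonds start. -/
theorem window_eq_two {l N : ℕ} (hn : 3 < n) (hln : l ≤ n) (hN : 0 < N)
    {E : Finset (ZMod n × ZMod n)} (hE : E ∈ balancedSets (circulantDigraph n {1, 3}) l N)
    (v : ZMod n) :
    (hasArc E 1 v).toNat +
      ((hasArc E 3 v).toNat + (hasArc E 3 (v - 1)).toNat + (hasArc E 3 (v - 2)).toNat) = 2 := by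
  obtain ⟨hadj, hbal, hl, hN'⟩ := mem_balancedSets.1 hE
  simp only [card_filter_fst_eq hn hadj, card_filter_snd_eq hn hadj] at hbal hN'
  have hle : ∀ b : Bool, b.toNat ≤ 1 := Bool.toNat_le
  rw [card_eq_sum_hasArc hn hadj] at hl
  set x : ZMod n → ℕ := fun v => (hasArc E 1 v).toNat with hx
  set y : ZMod n → ℕ := fun v => (hasArc E 3 v).toNat with hy
  have hx1 : ∀ v, x v ≤ 1 := fun v => hle _
  have hy1 : ∀ v, y v ≤ 1 := fun v => hle _
  change ∀ v, x (v - 1) + y (v - 3) = x v + y v at hbal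
  change ∑ v, x v + ∑ v, y v = l at hl
  change x v + (y v + y (v - 1) + y (v - 2)) = 2
  obtain ⟨u, hu⟩ := Finset.card_pos.1 (hN' ▸ hN)
  simp only [Finset.mem_filter, Finset.mem_univ, true_and] at hu
  change x u + y u = 2 at hu
  -- Balance at `v + 1` says that moving the cut from `v` to `v + 1` loses as many bonds as it
  -- gains.
  obtain ⟨k, hk⟩ : ∃ k, ∀ v, x v + (y v + y (v - 1) + y (v - 2)) = k := by
    refine ⟨x 0 + (y 0 + y (0 - 1) + y (0 - 2)), fun v => ?_⟩
    have hstep : ∀ v, x (v + 1) + (y (v + 1) + y (v + 1 - 1) + y (v + 1 - 2)) =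
        x v + (y v + y (v - 1) + y (v - 2)) := by
      intro v
      have := hbal (v + 1)
      rw [show v + 1 - 1 = v by ring, show v + 1 - 3 = v - 2 by ring] at this
      rw [show v + 1 - 1 = v by ring, show v + 1 - 2 = v - 1 by ring]
      omega
    have hnat : ∀ i : ℕ, x i + (y i + y (i - 1) + y (i - 2)) =
        x 0 + (y 0 + y (0 - 1) + y (0 - 2)) := by
      intro i
      induction i with
      | zero => simp
      | succ i ih => rw [← ih, ← hstep i]; push_cast; rfl
    simpa using hnat v.val
  have hsum : ∑ v, x v + 3 * ∑ v, y v = n * k := by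
    rw [← sum_window, ← Finset.sum_add_distrib, Finset.sum_congr rfl fun v _ => hk v]
    simp
  have hY : ∑ v, (1 - y v) + ∑ v, y v = n := by
    rw [← Finset.sum_add_distrib, Finset.sum_congr rfl fun v _ => Nat.sub_add_cancel (hy1 v)]
    simp
  have hk2 : 2 ≤ k := by
    have := hk u
    omega
  rw [hk v]
  by_contra hne
  -- Here `n * k = l + 2 * ∑ y ≤ 3 * n`, so `k = 3` and every `y v` is 1. But at `u` also `x u = 1`,
  -- which makes the window sum 4.
  have hk3 : 3 ≤ k := by omega
  have hnk : n * 3 ≤ n * k := Nat.mul_le_mul_left n hk3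
  have hk3' : n * k = n * 3 := by omega
  have hk3'' : k = 3 := Nat.eq_of_mul_eq_mul_left (by omega) hk3'
  have hzero : ∑ v, (1 - y v) = 0 := by omega
  have hy_one : ∀ v, y v = 1 := by
    intro v
    have := (Finset.sum_eq_zero_iff.1 hzero) v (Finset.mem_univ v)
    have := hy1 v
    omega
  have := hk u
  rw [hy_one, hy_one, hy_one] at this
  rw [hy_one] at hu
  omega

/-- A set of bonds such that two of them cross each cut of the circle is balanced. -/
theorem mem_balancedSets_iff_of_window {l N : ℕ} (hn : 3 < n) {E : Finset (ZMod n × ZMod n)}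
    (hadj : ∀ e ∈ E, (circulantDigraph n {1, 3}).Adj e.1 e.2)
    (hw : ∀ v, (hasArc E 1 v).toNat +
      ((hasArc E 3 v).toNat + (hasArc E 3 (v - 1)).toNat + (hasArc E 3 (v - 2)).toNat) = 2) :
    E ∈ balancedSets (circulantDigraph n {1, 3}) l N ↔
      ∃ Z, l = 2 * Z ∧ hasArc E 3 ∈ cyclicWords n Z N := by
  have hbal : ∀ v, (E.filter fun e => e.2 = v).card = (E.filter fun e => e.1 = v).card := by
    intro v
    rw [card_filter_fst_eq hn hadj, card_filter_snd_eq hn hadj]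
    have h1 := hw v
    have h2 := hw (v - 1)
    rw [show v - 1 - 1 = v - 2 by ring, show v - 1 - 2 = v - 3 by ring] at h2
    omega
  -- Summing the windows gives `∑ x + 3 * ∑ y = 2 * n`, hence `∑ x + ∑ y = 2 * (n - ∑ y)`.
  have hcard : E.card = 2 * (Finset.univ.filter fun v => hasArc E 3 v = false).card := by
    have h1 := card_filter_false_add_sum (hasArc E 3)
    have h2 := Finset.sum_congr (s₁ := Finset.univ) rfl fun v _ => hw v
    rw [Finset.sum_add_distrib, sum_window fun v => (hasArc E 3 v).toNat] at h2
    simp only [Finset.sum_const, Finset.card_univ, ZMod.card, smul_eq_mul] at h2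
    rw [card_eq_sum_hasArc hn hadj]
    omega
  have hdz : (Finset.univ.filter fun v => (E.filter fun e => e.1 = v).card = 2).card =
      (Finset.univ.filter fun v => hasArc E 3 v = false ∧ hasArc E 3 (v + 1) = false).card := by
    -- The window sum is 2, so `x v + y v = 2` leaves nothing for `y (v - 1)` and `y (v - 2)`, and
    -- conversely.
    have hiff : ∀ v, (E.filter fun e => e.1 = v).card = 2 ↔
        hasArc E 3 (v - 2) = false ∧ hasArc E 3 (v - 1) = false := by
      intro v
      rw [card_filter_fst_eq hn hadj]
      have h1 := hw v
      cases h : hasArc E 3 (v - 2) <;> cases h' : hasArc E 3 (v - 1) <;> simp [h, h'] at h1 ⊢ <;>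
        omega
    simp only [hiff]
    refine Finset.card_nbij' (· - 2) (· + 2) ?_ ?_ ?_ ?_
    · intro v hv
      simpa [show v - 2 + 1 = v - 1 by ring] using hv
    · intro v hv
      simpa [show v + 2 - 1 = v + 1 by ring] using hv
    · intro v _
      simp
    · intro v _
      simp
  -- As `x` is 0 or 1, three consecutive values of `y` sum to 2 or 1, never to 0 or 3.
  have hT : NoTriple (hasArc E 3) := by
    rintro v ⟨h1, h2⟩
    have := hw (v + 2)
    rw [show v + 2 - 1 = v + 1 by ring, show v + 2 - 2 = v by ring, h1, h2] at this
    have hx := Bool.toNat_le (hasArc E 1 (v + 2))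
    cases h : hasArc E 3 (v + 2) <;> simp [h] at this
    omega
  rw [mem_balancedSets, hcard, hdz]
  simp only [mem_cyclicWords]
  constructor
  · rintro ⟨-, -, hl, hN⟩
    exact ⟨_, hl.symm, hT, rfl, hN⟩
  · rintro ⟨Z, rfl, -, rfl, hN⟩
    exact ⟨hadj, hbal, rfl, hN⟩

theorem even_of_mem_balancedSets {l N : ℕ} (hn : 3 < n) (hln : l ≤ n) (hN : 0 < N)
    {E : Finset (ZMod n × ZMod n)} (hE : E ∈ balancedSets (circulantDigraph n {1, 3}) l N) :
    ∃ Z, l = 2 * Z := by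
  obtain ⟨Z, hZ, -⟩ := (mem_balancedSets_iff_of_window hn (mem_balancedSets.1 hE).1
    (window_eq_two hn hln hN hE)).1 hE
  exact ⟨Z, hZ⟩

theorem card_balancedSets {Z N : ℕ} (hn : 3 < n) (hln : 2 * Z ≤ n) (hN : 0 < N) :
    (balancedSets (circulantDigraph n {1, 3}) (2 * Z) N).card = (cyclicWords n Z N).card := by
  have h2 := ZMod.natCast_ne_zero_of_lt (n := n) (a := 2) (by norm_num) (by omega)
  push_cast at h2
  refine Finset.card_bij (fun E _ => hasArc E 3) ?_ ?_ ?_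
  · intro E hE
    obtain ⟨Z', hZ, h⟩ := (mem_balancedSets_iff_of_window hn (mem_balancedSets.1 hE).1
      (window_eq_two hn hln hN hE)).1 hE
    obtain rfl : Z = Z' := by omega
    exact h
  · intro E hE E' hE' h
    have hw := window_eq_two hn hln hN hE
    have hw' := window_eq_two hn hln hN hE'
    have h1 : hasArc E 1 = hasArc E' 1 := by
      funext v
      have e1 := hw v
      have e2 := hw' v
      rw [h] at e1
      cases h3 : hasArc E 1 v <;> cases h4 : hasArc E' 1 v <;> simp [h3, h4] at e1 e2 ⊢ <;> omega
    have key : ∀ a v, hasArc E a = hasArc E' a → ((v, v + a) ∈ E ↔ (v, v + a) ∈ E') := by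
      intro a v ha
      simpa [hasArc] using congrFun ha v
    ext ⟨v, w⟩
    by_cases hvw : (circulantDigraph n {1, 3}).Adj v w
    · rcases circulantDigraph_one_three_adj.1 hvw with rfl | rfl
      · exact key 1 v h1
      · exact key 3 v h
    · exact iff_of_false (fun h => hvw ((mem_balancedSets.1 hE).1 _ h))
        (fun h => hvw ((mem_balancedSets.1 hE').1 _ h))
  · intro y hy
    -- The bond of step 1 must fill the window up to 2. Without triples the three letters sum to 1
    -- or 2, so it is needed exactly when they do not sum to 2.
    let E : Finset (ZMod n × ZMod n) := Finset.univ.filter fun e =>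
      (e.2 = e.1 + 3 ∧ y e.1 = true) ∨
        (e.2 = e.1 + 1 ∧ (y e.1).toNat + (y (e.1 - 1)).toNat + (y (e.1 - 2)).toNat ≠ 2)
    have hadj : ∀ e ∈ E, (circulantDigraph n {1, 3}).Adj e.1 e.2 := by
      intro e he
      rw [circulantDigraph_one_three_adj]
      simp only [E, Finset.mem_filter] at he
      tauto
    have h31 : ∀ v : ZMod n, v + 3 ≠ v + 1 := fun v h => h2 (by linear_combination h)
    have h3 : hasArc E 3 = y := by
      funext v
      simp [hasArc, E, h31 v]
    have h1 : ∀ v, hasArc E 1 v =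
        decide ((y v).toNat + (y (v - 1)).toNat + (y (v - 2)).toNat ≠ 2) := by
      intro v
      simp [hasArc, E, (h31 v).symm]
    have hw : ∀ v, (hasArc E 1 v).toNat + ((hasArc E 3 v).toNat + (hasArc E 3 (v - 1)).toNat +
        (hasArc E 3 (v - 2)).toNat) = 2 := by
      intro v
      have hT := (mem_cyclicWords.1 hy).1 (v - 2)
      rw [show v - 2 + 1 = v - 1 by ring, show v - 2 + 2 = v by ring] at hT
      rw [h1, h3]
      cases e1 : y v <;> cases e2 : y (v - 1) <;> cases e3 : y (v - 2) <;>
        simp [e1, e2, e3] at hT ⊢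
    exact ⟨E, (mem_balancedSets_iff_of_window hn hadj hw).2 ⟨Z, rfl, h3 ▸ hy⟩, h3⟩

end circulant

/-! ### The closed formula -/

theorem binom_natCast (a b : ℕ) : binom a b = a.choose b := by
  simp [binom]

theorem binom_eq_zero_of_neg {x : ℚ} (hx : x < 0) (y : ℚ) : binom x y = 0 := by
  rw [binom, if_neg]
  rintro ⟨h, -⟩
  rw [h] at hx
  exact absurd hx (not_lt.2 (Nat.cast_nonneg _))

theorem mainTheorem4 (n l N : ℕ) (hn : 3 < n) (hl : 0 < l) (hln : l ≤ n) (hN : 0 < N) :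
    (primitivePseudoOrbits (circulantDigraph n {1, 3}) l N).Finite ∧
      ((primitivePseudoOrbits (circulantDigraph n {1, 3}) l N).ncard : ℚ) =
        2 ^ N * ((n : ℚ) / N) * binom ((l : ℚ) / 2 - N) ((n : ℚ) - l + N) *
          binom ((l : ℚ) / 2 - N - 1) ((N : ℚ) - 1) := by
  have : NeZero n := ⟨by omega⟩
  obtain ⟨hfin, hcard⟩ := finite_and_ncard_primitivePseudoOrbits (l := l) (N := N)
    (not_circulantDigraph_adj_self hn)
    (fun v => ⟨v + 1, v + 3, fun w => circulantDigraph_one_three_adj.1⟩)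
  refine ⟨hfin, ?_⟩
  rw [hcard]
  by_cases heven : ∃ Z, l = 2 * Z
  · obtain ⟨Z, rfl⟩ := heven
    rw [card_balancedSets hn hln hN]
    have hhalf : ((2 * Z : ℕ) : ℚ) / 2 = Z := by push_cast; ring
    rw [hhalf]
    -- For `Z ≤ N` there are no words, and the last binomial coefficient has a negative upper entry.
    rcases le_or_gt Z N with hZN | hZN
    · have hneg : (Z : ℚ) - N - 1 < 0 := by
        have : (Z : ℚ) ≤ N := by exact_mod_cast hZN
        linarith
      rw [cyclicWords_eq_empty hZN, binom_eq_zero_of_neg hneg]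
      simp
    -- Here `b + 1` is the number of blocks, so that `b` is the upper entry `l / 2 - N - 1`.
    · obtain ⟨b, rfl⟩ : ∃ b, Z = b + 1 + N := ⟨Z - N - 1, by omega⟩
      obtain ⟨M, hM⟩ : ∃ M, n = 2 * (b + 1) + N + M := ⟨n - 2 * (b + 1) - N, by omega⟩
      obtain ⟨K, rfl⟩ : ∃ K, N = K + 1 := ⟨N - 1, by omega⟩
      have h1 := mul_card_cyclicWords (Z := b + 1 + (K + 1)) (by omega) rfl hM
      -- The absorption identity exchanges the factor 1 / (number of blocks) for 1 / N.
      have h2 := Nat.add_one_mul_choose_eq b K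
      have e1 : ((b + 1 + (K + 1) : ℕ) : ℚ) - (K + 1 : ℕ) = (b + 1 : ℕ) := by push_cast; ring
      have e2 : (n : ℚ) - (2 * (b + 1 + (K + 1)) : ℕ) + (K + 1 : ℕ) = (M : ℕ) := by
        rw [hM]; push_cast; ring
      have e3 : ((b + 1 : ℕ) : ℚ) - 1 = b := by push_cast; ring
      have e4 : ((K + 1 : ℕ) : ℚ) - 1 = K := by push_cast; ring
      rw [e1, e2, e3, e4, binom_natCast, binom_natCast]
      have hb : ((b + 1 : ℕ) : ℚ) ≠ 0 := by positivity
      have hK : ((K + 1 : ℕ) : ℚ) ≠ 0 := by positivity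
      have h1' : ((b + 1 : ℕ) : ℚ) * (cyclicWords n (b + 1 + (K + 1)) (K + 1)).card =
          n * (((b + 1).choose (K + 1) : ℕ) * ((b + 1).choose M : ℕ)) := by exact_mod_cast h1
      have h2' : ((b + 1 : ℕ) : ℚ) * (b.choose K : ℕ) =
          ((b + 1).choose (K + 1) : ℕ) * (K + 1 : ℕ) := by exact_mod_cast h2
      have h3 : ((cyclicWords n (b + 1 + (K + 1)) (K + 1)).card : ℚ) =
          (n : ℚ) / (K + 1 : ℕ) * ((b + 1).choose M : ℕ) * (b.choose K : ℕ) := by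
        apply mul_left_cancel₀ hb
        rw [h1', div_mul_eq_mul_div, div_mul_eq_mul_div, mul_div_assoc', eq_div_iff hK]
        linear_combination (-(n : ℚ) * ((b + 1).choose M : ℕ)) * h2'
      rw [Nat.cast_mul, h3]
      push_cast
      ring
  · have hempty : balancedSets (circulantDigraph n {1, 3}) l N = ∅ :=
      Finset.eq_empty_of_forall_notMem fun E hE =>
        heven (even_of_mem_balancedSets hn hln hN hE)
    -- If `l / 2 - N` were a natural number, `l` would be even.
    have hbin : binom ((l : ℚ) / 2 - N) ((n : ℚ) - l + N) = 0 := by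
      rw [binom, if_neg]
      rintro ⟨h, -⟩
      refine heven ⟨⌊(l : ℚ) / 2 - N⌋₊ + N, ?_⟩
      have : (l : ℚ) = 2 * (⌊(l : ℚ) / 2 - N⌋₊ + N) := by
        rw [← h]; ring
      exact_mod_cast this
    rw [hempty, hbin]
    simp
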